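/- A discrete OCF game is a triple $\mathcal G=\langle N,\vec W,v\rangle$ with agents $N=\{1,\dots,n\}$, weights $W_i\in\mathbb Z_{\ge 0}$ and a characteristic function $v:\mathcal W\to\mathbb R_{\ge 0}$ with $v(\vec 0)=0$, where $\mathcal W=\{\vec c\in\mathbb Z_{\ge 0}^n : \vec c\le\vec W\}$ is the set of coalitions. Let $W_M=\max_i W_i$ and $\mathrm{supp}(\vec c)=\{i : c^i>0\}$. A coalition structure is a finite multiset $CS$ of coalitions with $\sum_{\vec d\in CS}\vec d\le\vec W$, and for $\vec c\in\mathcal W$ $$v^*(\vec c)=\max\Big\{\sum_{\vec d\in CS}v(\vec d) \;:\; CS \text{ a coalition structure},\ \sum_{\vec d\in CS}\vec d=\vec c\Big\}.$$ The game is a 2-OCF game if $v(\vec c)=0$ whenever $|\mathrm{supp}(\vec c)|>2$. It has a tree interaction structure if there is a tree $T$ with vertex set $N$ such that $v(\vec c)=0$ for every $\vec c\in\mathcal W$ whose support does not induce a connected subgraph of $T$. An instance of $\textsc{OptVal}$ consists of a game $\mathcal G$, a coalition $\vec c\in\mathcal W$ and a number $V\in\mathbb Q$; it is a yes-instance if and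 only if $v^*(\vec c)\ge V$. **Theorem.** For the family of discrete 2-OCF games with a tree interaction structure, $\textsc{OptVal}$ can be decided, and the optimal value $v^*(\vec c)$ (in particular $v^*(\vec W)$) can be computed, in time polynomial in $n$ and $W_M$. That is, there are one random access machine program and one polynomial $p$ such that for every such game $\mathcal G$, every $\vec c\in\mathcal W$ and every $V\in\mathbb Q$, the program, given $n,\vec W,\vec c,V$ and oracle access to $v$ (the tree is not given), halts after time at most $p(n,W_M)$, having computed $v^*(\vec c)$ and the answer to the instance $(\mathcal G,\vec c,V)$. Here additions, truncated subtractions and comparisons of integers, additions, comparisons and copies of values (real numbers), and memory accesses take one step each, and an oracle query takes $n+1$ steps. -/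

import Mathlib

/-- A discrete overlapping coalition formation game with agents `Fin n`: every agent `i` has an
integer weight `W i`, and the characteristic function `v` gives a nonnegative value to every
coalition, i.e. to every integer vector `0 ≤ c ≤ W`. The zero vector has value `0`, so that the
optimal value of a coalition structure (a multiset of coalitions) is finite. -/
structure OCFGame (n : ℕ) where
  W : Fin n → ℕ
  v : Set.Iic W → ℝ
  v_nonneg : ∀ c, 0 ≤ v c
  v_zero : ∀ c, (∀ i, c.1 i = 0) → v c = 0

namespace OCFGame

/-- Coalitions: the vectors `c` with `0 ≤ c i ≤ W i` for every agent `i`. -/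
abbrev Coalition {n : ℕ} (G : OCFGame n) : Type := Set.Iic G.W

/-- The maximal weight of an agent. -/
def maxWeight {n : ℕ} (G : OCFGame n) : ℕ := Finset.univ.sup G.W

/-- The agents that contribute to a coalition. -/
def supp {n : ℕ} (G : OCFGame n) (c : G.Coalition) : Finset (Fin n) :=
  Finset.univ.filter (fun i => 0 < c.1 i)

/-- `k`-OCF games: coalitions with more than `k` contributing agents have value `0`. -/
def IsKOCF {n : ℕ} (G : OCFGame n) (k : ℕ) : Prop :=
  ∀ c : G.Coalition, k < (G.supp c).card → G.v c = 0

open Classical in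
/-- The game reduced to a graph: a coalition keeps its value if its support induces a connected
subgraph, and has value `0` otherwise. -/
noncomputable def restrict {n : ℕ} (G : OCFGame n) (T : SimpleGraph (Fin n)) : OCFGame n where
  W := G.W
  v := fun c => if (T.induce (G.supp c : Set (Fin n))).Connected then G.v c else 0
  v_nonneg := by
    intro c
    split_ifs
    · exact G.v_nonneg c
    · exact le_rfl
  v_zero := by
    intro c hc
    split_ifs
    · exact G.v_zero c hc
    · rfl

/-- Tree interaction structure: the game equals its reduction to some tree on the agents. -/
def HasTreeInteraction {n : ℕ} (G : OCFGame n) : Prop :=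
  ∃ T : SimpleGraph (Fin n), T.IsTree ∧ G.restrict T = G

/-- The total contribution of every agent to a list of coalitions. -/
def weight {n : ℕ} (G : OCFGame n) (CS : Multiset G.Coalition) : Fin n → ℕ :=
  (CS.map Subtype.val).sum

/-- A coalition structure is a finite multiset of coalitions in which no agent contributes more
than its weight. -/
def IsCoalitionStructure {n : ℕ} (G : OCFGame n) (CS : Multiset G.Coalition) : Prop :=
  G.weight CS ≤ G.W

/-- The total value of the coalitions in a coalition structure. -/
noncomputable def value {n : ℕ} (G : OCFGame n) (CS : Multiset G.Coalition) : ℝ :=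
  (CS.map G.v).sum

/-- The values of the coalition structures whose weight is exactly `c`. -/
def valueSet {n : ℕ} (G : OCFGame n) (c : G.Coalition) : Set ℝ :=
  {x | ∃ CS : Multiset G.Coalition, G.IsCoalitionStructure CS ∧ G.weight CS = c.1 ∧
    G.value CS = x}

/-- The superadditive cover of `v`: the largest value of a coalition structure of weight `c`
(a maximum, see `isGreatest_superadditiveCover`). -/
noncomputable def superadditiveCover {n : ℕ} (G : OCFGame n) (c : G.Coalition) : ℝ :=
  sSup (G.valueSet c)

/-- The maximum in the definition of the superadditive cover exists. -/
theorem isGreatest_superadditiveCover {n : ℕ} (G : OCFGame n) (c : G.Coalition) :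
    IsGreatest (G.valueSet c) (G.superadditiveCover c) := by
  classical
  have hne : (G.valueSet c).Nonempty :=
    ⟨G.value {c}, {c}, by
      simp only [IsCoalitionStructure, weight, Multiset.map_singleton, Multiset.sum_singleton]
      exact c.2, by simp [weight], rfl⟩
  have hfinType : Finite G.Coalition := (Set.finite_Iic G.W).to_subtype
  have hfin : (G.valueSet c).Finite := by
    have hS : ({CS : Multiset G.Coalition | CS.card ≤ ∑ i, c.1 i}).Finite := by
      have : {CS : Multiset G.Coalition | CS.card ≤ ∑ i, c.1 i} ⊆
          ⋃ k ∈ Set.Iic (∑ i, c.1 i), Set.range (fun s : Sym G.Coalition k => s.1) := by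
        intro CS hCS
        simp only [Set.mem_iUnion]
        exact ⟨CS.card, hCS, ⟨CS, rfl⟩, rfl⟩
      exact ((Set.finite_Iic _).biUnion (fun k _ => Set.finite_range _)).subset this
    refine (hS.image G.value).subset ?_
    rintro x ⟨CS, -, hw, rfl⟩
    let p : G.Coalition → Prop := fun d => ∃ i, d.1 i ≠ 0
    have hsplit := Multiset.filter_add_not p CS
    have hval : G.value (CS.filter p) = G.value CS := by
      have h0 : ((CS.filter (fun d => ¬ p d)).map G.v).sum = 0 := by
        apply Multiset.sum_eq_zero
        intro y hy
        obtain ⟨d, hd, rfl⟩ := Multiset.mem_map.1 hy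
        refine G.v_zero d fun i => ?_
        by_contra h
        exact (Multiset.mem_filter.1 hd).2 ⟨i, h⟩
      unfold value
      conv_rhs => rw [← hsplit]
      rw [Multiset.map_add, Multiset.sum_add, h0, add_zero]
    have hcard : ∀ D : Multiset G.Coalition, (∀ d ∈ D, p d) → D.card ≤ ∑ i, G.weight D i := by
      intro D
      induction D using Multiset.induction_on with
      | empty => intro _; simp
      | cons a D ih =>
        intro hD
        obtain ⟨i, hi⟩ := hD a (Multiset.mem_cons_self a D)
        have h1 : 1 ≤ ∑ i, a.1 i :=
          (Nat.one_le_iff_ne_zero.2 hi).trans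
            (Finset.single_le_sum (f := a.1) (fun _ _ => Nat.zero_le _) (Finset.mem_univ i))
        have h2 := ih fun d hd => hD d (Multiset.mem_cons_of_mem hd)
        simp only [weight, Multiset.map_cons, Multiset.sum_cons, Multiset.card_cons,
          Pi.add_apply, Finset.sum_add_distrib] at h2 ⊢
        omega
    refine ⟨CS.filter p, ?_, hval⟩
    refine (hcard _ fun d hd => (Multiset.mem_filter.1 hd).2).trans ?_
    refine Finset.sum_le_sum fun i _ => ?_
    rw [← hw]
    unfold weight
    conv_rhs => rw [← hsplit]
    rw [Multiset.map_add, Multiset.sum_add]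
    exact Nat.le_add_right _ _
  exact ⟨hne.csSup_mem hfin, fun x hx => le_csSup hfin.bddAbove hx⟩

open Classical in
/-- The value oracle of the game: the value of `d` if `d` is a coalition; vectors `d` that are not
coalitions are answered by `0`. -/
noncomputable def oracle {n : ℕ} (G : OCFGame n) (d : Fin n → ℕ) : ℝ :=
  if h : d ≤ G.W then G.v ⟨d, h⟩ else 0

end OCFGame

/-- Instructions of a random access machine with oracle access to the characteristic function.
The machine has integer registers `reg`, an integer memory `mem` and a memory `val` for values
(real numbers); both memories are addressed through registers. Values can only be copied, added,
compared and obtained from the oracle; a program contains no real constants.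

* `const r k`: `reg r := k`;
* `add r a b`, `sub r a b`: `reg r := reg a + reg b`, `reg r := reg a - reg b` (truncated at `0`);
* `jlt a b l`: go to instruction `l` if `reg a < reg b`;
* `load r a`: `reg r := mem (reg a)`;  `store a b`: `mem (reg a) := reg b`;
* `vcopy a b`: `val (reg a) := val (reg b)`;
* `vadd a b c`: `val (reg a) := val (reg b) + val (reg c)`;
* `vjle a b l`: go to instruction `l` if `val (reg a) ≤ val (reg b)`;
* `query a b`: `val (reg a) :=` the value of the vector stored in the `n` memory cells
  `mem (reg b), …, mem (reg b + n - 1)`. -/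
inductive Instr : Type
  | const (r k : ℕ)
  | add (r a b : ℕ)
  | sub (r a b : ℕ)
  | jlt (a b l : ℕ)
  | load (r a : ℕ)
  | store (a b : ℕ)
  | vcopy (a b : ℕ)
  | vadd (a b c : ℕ)
  | vjle (a b l : ℕ)
  | query (a b : ℕ)

/-- A program is a finite list of instructions, numbered from `0`. -/
abbrev Program : Type := List Instr

/-- A configuration: program counter, registers, integer memory and value memory. -/
structure Config where
  pc : ℕ
  reg : ℕ → ℕ
  mem : ℕ → ℕ
  val : ℕ → ℝ

open Classical in
/-- The effect of one instruction. -/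
noncomputable def Instr.exec {n : ℕ} (G : OCFGame n) (s : Config) : Instr → Config
  | .const r k => { s with pc := s.pc + 1, reg := Function.update s.reg r k }
  | .add r a b => { s with pc := s.pc + 1, reg := Function.update s.reg r (s.reg a + s.reg b) }
  | .sub r a b => { s with pc := s.pc + 1, reg := Function.update s.reg r (s.reg a - s.reg b) }
  | .jlt a b l => { s with pc := if s.reg a < s.reg b then l else s.pc + 1 }
  | .load r a => { s with pc := s.pc + 1, reg := Function.update s.reg r (s.mem (s.reg a)) }
  | .store a b => { s with pc := s.pc + 1, mem := Function.update s.mem (s.reg a) (s.reg b) }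
  | .vcopy a b =>
      { s with pc := s.pc + 1, val := Function.update s.val (s.reg a) (s.val (s.reg b)) }
  | .vadd a b c =>
      { s with
        pc := s.pc + 1
        val := Function.update s.val (s.reg a) (s.val (s.reg b) + s.val (s.reg c)) }
  | .vjle a b l => { s with pc := if s.val (s.reg a) ≤ s.val (s.reg b) then l else s.pc + 1 }
  | .query a b =>
      { s with
        pc := s.pc + 1
        val := Function.update s.val (s.reg a)
          (G.oracle (fun i : Fin n => s.mem (s.reg b + i))) }

/-- The time that an instruction takes in a game with `n` agents: reading the `n` coordinates of
an oracle query is charged for, every other instruction takes one step. -/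
def Instr.cost (n : ℕ) : Instr → ℕ
  | .query _ _ => n + 1
  | _ => 1

/-- `Run P G s t s'`: started in the configuration `s`, the program `P` with oracle access to the
game `G` halts, after time exactly `t`, in the configuration `s'`. The machine halts when the
program counter leaves the program. -/
inductive Run {n : ℕ} (P : Program) (G : OCFGame n) : Config → ℕ → Config → Prop
  | halt (s : Config) : P[s.pc]? = none → Run P G s 0 s
  | step (s : Config) (ins : Instr) (t : ℕ) (s' : Config) :
      P[s.pc]? = some ins → Run P G (ins.exec G s) t s' → Run P G s (ins.cost n + t) s'

/-- The input of an instance `(G, c, V)`: register `0` holds `n`, the memory holds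
`W 0, …, W (n-1), c 0, …, c (n-1)`, and cell `0` of the value memory holds `V`; everything else
is `0`. The characteristic function is available through the oracle only, and the interaction
tree is not given. -/
noncomputable def initialConfig {n : ℕ} (G : OCFGame n) (c : G.Coalition) (V : ℚ) : Config where
  pc := 0
  reg := fun r => if r = 0 then n else 0
  mem := fun a =>
    if h : a < n then G.W ⟨a, h⟩ else if h' : a - n < n then c.1 ⟨a - n, h'⟩ else 0
  val := fun a => if a = 0 then (V : ℝ) else 0

/-! The proof is leaf elimination by dynamic programming, arranged so that the tree need not be
known. Each remaining agent `k` carries a table `g k`, where `g k a` is the best extra value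
obtainable from `a` units of `k` left unused by coalitions among the remaining agents. A structure
is scored by the values of its members plus the table rewards for its leftovers. With zero tables
this optimum is `v^*(c)` (`isOptimum_superadditiveCover`).

Suppose that every valuable coalition using `i` involves no remaining agent other than `i` and `j`.
Then `i` can be merged into `j`: the members using `i` form bundles `(p, q)` on `i` and `j`, and a
two-dimensional unbounded knapsack `h x y` optimises over these bundles together with both leftover
rewards. Replacing `g j y` by `h (c i) y` and deleting `i` keeps the optimum (`IsOptimum.merge`). An
extra index `n` of bound `0` serves as partner for agents with no neighbour left; when it alone
remains, its table entry at `0` is the answer (`IsOptimum.eq_of_singleton`).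

A suitable pair is recognised by oracle queries: `IsIsolated` asks that no bundle of `i` with a
third remaining agent has positive value. For a `2`-OCF game this suffices for the merge
(`isOptimum_merge`), whatever the tree is. The tree only guarantees progress: in a forest some
remaining vertex has at most one remaining neighbour, so some pair passes (`exists_isIsolated`).
Hence `n` rounds over all pairs eliminate all agents.

The machine part writes this as a structured program `Cmd`, compiles it, and bounds its time by a
polynomial in a common bound on loop limits and instruction costs (`run_code`). All tables have side
`K = n + 3 + ∑ i, W i`, which is polynomial in `n` and `W_M`. -/

/-! ### Leaves in forests -/

/-- In a nonempty set of vertices of a finite forest, some vertex has at most one neighbour in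
the set. -/
theorem SimpleGraph.IsAcyclic.exists_subsingleton_neighbors {α : Type*} [Fintype α]
    {T : SimpleGraph α} (hT : T.IsAcyclic) {S : Set α} (hS : S.Nonempty) :
    ∃ i ∈ S, ∀ k ∈ S, ∀ l ∈ S, T.Adj i k → T.Adj i l → k = l := by
  classical
  have hF : (T.induce S).IsAcyclic := hT.induce S
  -- The start of a longest path inside `S` is the vertex sought: a neighbour off the path would
  -- prolong it, and a neighbour on the path other than the second vertex would close a cycle.
  let Q : ℕ → Prop := fun m => ∃ (u v : S) (p : (T.induce S).Walk u v), p.IsPath ∧ p.length = m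
  obtain ⟨x, hx⟩ := hS
  have hQ0 : Q 0 := ⟨⟨x, hx⟩, ⟨x, hx⟩, .nil, by simp, rfl⟩
  have hmax := Nat.findGreatest_spec (P := Q) (Nat.zero_le (Fintype.card S)) hQ0
  obtain ⟨u, v, p, hp, hl⟩ := hmax
  have key : ∀ w : S, (T.induce S).Adj u w → w = p.snd := by
    intro w hw
    refine hF.eq_snd_of_adj_start hp hw ?_
    by_contra hmem
    have hp' : (SimpleGraph.Walk.cons hw.symm p).IsPath := hp.cons hmem
    have := Nat.le_findGreatest (P := Q) hp'.length_lt.le ⟨_, _, _, hp', rfl⟩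
    rw [SimpleGraph.Walk.length_cons] at this
    omega
  refine ⟨u, u.2, fun k hk l hl h1 h2 => ?_⟩
  have e1 := key ⟨k, hk⟩ (by simpa using h1)
  have e2 := key ⟨l, hl⟩ (by simpa using h2)
  exact congrArg Subtype.val (e1.trans e2.symm)

/-! ### Elimination of one index by a two-dimensional knapsack -/

namespace MergeDP

/-- The vector with entry `p` at `i` and `q` at `j`, and `0` elsewhere. -/
def pairVec (i p j q : ℕ) : ℕ → ℕ := Function.update (Function.update 0 i p) j q

theorem pairVec_left {i j : ℕ} (h : i ≠ j) (p q : ℕ) : pairVec i p j q i = p := by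
  simp [pairVec, h]

theorem pairVec_right (i p j q : ℕ) : pairVec i p j q j = q := by
  simp [pairVec]

theorem pairVec_other {i j k : ℕ} (hi : k ≠ i) (hj : k ≠ j) (p q : ℕ) :
    pairVec i p j q k = 0 := by
  simp [pairVec, hi, hj]

/-- A multiset of vectors is feasible for the bound `c` and the index set `A` if all its members
vanish outside of `A` and its sum is at most `c`. -/
def Feasible (c : ℕ → ℕ) (A : Finset ℕ) (CS : Multiset (ℕ → ℕ)) : Prop :=
  (∀ d ∈ CS, ∀ k ∉ A, d k = 0) ∧ CS.sum ≤ c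

/-- The value of a multiset of vectors, where `g k a` rewards the unused weight `a` at `k`. -/
noncomputable def score (O : (ℕ → ℕ) → ℝ) (c : ℕ → ℕ) (A : Finset ℕ) (g : ℕ → ℕ → ℝ)
    (CS : Multiset (ℕ → ℕ)) : ℝ :=
  (CS.map O).sum + ∑ k ∈ A, g k (c k - CS.sum k)

/-- `z` is the optimal score. The optimum is attained by vectors of positive value. -/
def IsOptimum (O : (ℕ → ℕ) → ℝ) (c : ℕ → ℕ) (A : Finset ℕ) (g : ℕ → ℕ → ℝ) (z : ℝ) : Prop :=
  (∀ CS, Feasible c A CS → score O c A g CS ≤ z) ∧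
    ∃ CS, Feasible c A CS ∧ (∀ d ∈ CS, 0 < O d) ∧ z ≤ score O c A g CS

/-- `Reach gi gj u x y z`: the value `z` is obtained from the budgets `x` and `y` by buying bundles
`(p, q)` of value `u p q` and rewarding the rest through `gi` and `gj`. -/
inductive Reach (gi gj : ℕ → ℝ) (u : ℕ → ℕ → ℝ) : ℕ → ℕ → ℝ → Prop
  | base (x y : ℕ) : Reach gi gj u x y (gi x + gj y)
  | step (x y p q : ℕ) (z : ℝ) : Reach gi gj u x y z → Reach gi gj u (x + p) (y + q) (z + u p q)

/-- `h x y` is the largest value obtainable from the budgets `x` and `y`. -/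
structure IsMerge (gi gj : ℕ → ℝ) (u : ℕ → ℕ → ℝ) (K : ℕ) (h : ℕ → ℕ → ℝ) : Prop where
  base_le : ∀ x < K, ∀ y < K, gi x + gj y ≤ h x y
  step_le : ∀ x < K, ∀ y < K, ∀ p ≤ x, ∀ q ≤ y, h (x - p) (y - q) + u p q ≤ h x y
  reach : ∀ x < K, ∀ y < K, Reach gi gj u x y (h x y)

/-- Each purchase contributes one `pairVec`; it raises budget and consumption equally, so the
leftovers and their rewards stay those of the base case. -/
theorem Reach.exists_multiset {gi gj : ℕ → ℝ} {O : (ℕ → ℕ) → ℝ} {i j : ℕ} (hij : i ≠ j)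
    {x y : ℕ} {z : ℝ} (h : Reach gi gj (fun p q => O (pairVec i p j q)) x y z) :
    ∃ D : Multiset (ℕ → ℕ), (∀ d ∈ D, ∀ k, k ≠ i → k ≠ j → d k = 0) ∧ D.sum i ≤ x ∧ D.sum j ≤ y ∧
      z = (D.map O).sum + gi (x - D.sum i) + gj (y - D.sum j) := by
  induction h with
  | base x y => exact ⟨0, by simp⟩
  | step x y p q z _ ih =>
    obtain ⟨D, h1, h2, h3, rfl⟩ := ih
    refine ⟨pairVec i p j q ::ₘ D, ?_, ?_, ?_, ?_⟩
    · intro d hd k hki hkj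
      rcases Multiset.mem_cons.1 hd with rfl | hd
      · exact pairVec_other hki hkj p q
      · exact h1 d hd k hki hkj
    · simp [pairVec_left hij]; omega
    · simp [pairVec_right]; omega
    · have e1 : x + p - (p + D.sum i) = x - D.sum i := by omega
      have e2 : y + q - (q + D.sum j) = y - D.sum j := by omega
      simp [pairVec_left hij, pairVec_right, e1, e2]
      ring

theorem eq_pairVec {i j : ℕ} (hij : i ≠ j) {d : ℕ → ℕ} (h : ∀ k, k ≠ i → k ≠ j → d k = 0) :
    d = pairVec i (d i) j (d j) := by
  funext k
  by_cases hi : k = i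
  · subst hi; rw [pairVec_left hij]
  by_cases hj : k = j
  · subst hj; rw [pairVec_right]
  rw [pairVec_other hi hj, h k hi hj]

/-- Peel off one vector `d` at a time: the budgets shrink by `d i` and `d j`, and `step_le` pays for
`d`. -/
theorem IsMerge.le {gi gj : ℕ → ℝ} {O : (ℕ → ℕ) → ℝ} {i j K : ℕ} {h : ℕ → ℕ → ℝ} (hij : i ≠ j)
    (hh : IsMerge gi gj (fun p q => O (pairVec i p j q)) K h) (D : Multiset (ℕ → ℕ)) :
    ∀ x < K, ∀ y < K, (∀ d ∈ D, ∀ k, k ≠ i → k ≠ j → d k = 0) → D.sum i ≤ x → D.sum j ≤ y →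
      (D.map O).sum + gi (x - D.sum i) + gj (y - D.sum j) ≤ h x y := by
  induction D using Multiset.induction_on with
  | empty => intro x hx y hy _ _ _; simpa using hh.base_le x hx y hy
  | cons d D ih =>
    intro x hx y hy hD hi hj
    simp only [Multiset.sum_cons, Pi.add_apply, Multiset.map_cons] at hi hj ⊢
    have h1 := ih (x - d i) (by omega) (y - d j) (by omega)
      (fun e he => hD e (Multiset.mem_cons_of_mem he)) (by omega) (by omega)
    have h2 := hh.step_le x hx y hy (d i) (by omega) (d j) (by omega)
    rw [← eq_pairVec hij (hD d (Multiset.mem_cons_self d D))] at h2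
    rw [Nat.sub_sub, Nat.sub_sub] at h1
    linarith

theorem sum_apply_eq_zero {D : Multiset (ℕ → ℕ)} {k : ℕ} (h : ∀ d ∈ D, d k = 0) :
    D.sum k = 0 := by
  induction D using Multiset.induction_on with
  | empty => rfl
  | cons d D ih =>
    rw [Multiset.sum_cons, Pi.add_apply, h d (Multiset.mem_cons_self d D),
      ih fun e he => h e (Multiset.mem_cons_of_mem he)]

theorem sum_eq_add_erase_erase {A : Finset ℕ} {i j : ℕ} (hi : i ∈ A) (hj : j ∈ A) (hij : i ≠ j)
    (f : ℕ → ℝ) : ∑ k ∈ A, f k = f i + f j + ∑ k ∈ (A.erase i).erase j, f k := by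
  rw [← Finset.add_sum_erase A f hi,
    ← Finset.add_sum_erase (A.erase i) f (Finset.mem_erase.2 ⟨hij.symm, hj⟩), add_assoc]

/-- Eliminating `i` by merging its table into the one of `j` preserves the optimum, if all vectors
of positive value that use `i` use only `i` and `j`. -/
theorem IsOptimum.merge {O : (ℕ → ℕ) → ℝ} {c : ℕ → ℕ} {A : Finset ℕ} {g g' : ℕ → ℕ → ℝ} {z : ℝ}
    {i j K : ℕ} {h : ℕ → ℕ → ℝ} (hz : IsOptimum O c A g z) (hi : i ∈ A) (hj : j ∈ A)
    (hij : i ≠ j) (hciK : c i < K) (hcjK : c j < K)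
    (iso : ∀ d : ℕ → ℕ, (∀ k ∉ A, d k = 0) → d ≤ c → 0 < O d → d i ≠ 0 →
      ∀ k, k ≠ i → k ≠ j → d k = 0)
    (hh : IsMerge (g i) (g j) (fun p q => O (pairVec i p j q)) K h)
    (hgj : ∀ y ≤ c j, g' j y = h (c i) y)
    (hg : ∀ k ∈ A, k ≠ i → k ≠ j → ∀ y ≤ c k, g' k y = g k y) :
    IsOptimum O c (A.erase i) g' z := by
  obtain ⟨hS, CS, ⟨hC1, hC2⟩, hpos, hle⟩ := hz
  have hjA : j ∈ A.erase i := Finset.mem_erase.2 ⟨hij.symm, hj⟩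
  constructor
  · rintro CS ⟨h1, h2⟩
    have hCi : CS.sum i = 0 := sum_apply_eq_zero fun d hd => h1 d hd i (by simp)
    have hCj : CS.sum j ≤ c j := h2 j
    -- A structure avoiding `i` leaves all of `c i` free. The purchases behind the new table entry
    -- of `j` are added to it, giving a structure on `A` of the same score.
    obtain ⟨D, d1, d2, d3, d4⟩ :=
      (hh.reach (c i) hciK (c j - CS.sum j) (by omega)).exists_multiset hij
    have hDk : ∀ k, k ≠ i → k ≠ j → D.sum k = 0 := fun k hki hkj =>
      sum_apply_eq_zero fun d hd => d1 d hd k hki hkj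
    have hfe : Feasible c A (CS + D) := by
      constructor
      · intro d hd k hk
        rcases Multiset.mem_add.1 hd with hd | hd
        · exact h1 d hd k fun hk' => hk (Finset.mem_of_mem_erase hk')
        · exact d1 d hd k (by rintro rfl; exact hk hi) (by rintro rfl; exact hk hj)
      · intro k
        rw [Multiset.sum_add]
        change CS.sum k + D.sum k ≤ c k
        by_cases hki : k = i
        · subst hki; omega
        by_cases hkj : k = j
        · subst hkj; omega
        · rw [hDk k hki hkj]; exact h2 k
    refine le_trans (le_of_eq ?_) (hS _ hfe)
    unfold score
    rw [sum_eq_add_erase_erase hi hj hij, ← Finset.add_sum_erase _ _ hjA, hgj _ (by omega), d4,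
      Multiset.map_add, Multiset.sum_add, Multiset.sum_add, Pi.add_apply, Pi.add_apply, hCi,
      zero_add, Nat.sub_sub]
    have : ∑ k ∈ (A.erase i).erase j, g' k (c k - CS.sum k)
        = ∑ k ∈ (A.erase i).erase j, g k (c k - (CS.sum + D.sum) k) := by
      refine Finset.sum_congr rfl fun k hk => ?_
      simp only [Finset.mem_erase] at hk
      rw [Pi.add_apply, hDk k hk.2.1 hk.1, add_zero, hg k hk.2.2 hk.2.1 hk.1 _ (Nat.sub_le _ _)]
    rw [this]
    ring
  · classical
    -- Conversely, the members using `i` live on `i` and `j` by `iso`, which needs their positive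
    -- value. They are absorbed into the table, and `R` is the structure that remains.
    let D := CS.filter (fun d => d i ≠ 0)
    let R := CS.filter (fun d => ¬ d i ≠ 0)
    have hsplit : D + R = CS := Multiset.filter_add_not _ CS
    have hRm : ∀ d ∈ R, d ∈ CS ∧ d i = 0 := fun d hd => by
      have := Multiset.mem_filter.1 hd
      exact ⟨this.1, not_not.1 this.2⟩
    have hD1 : ∀ d ∈ D, ∀ k, k ≠ i → k ≠ j → d k = 0 := fun d hd => by
      have hd' := Multiset.mem_filter.1 hd
      exact iso d (hC1 d hd'.1) ((Multiset.le_sum_of_mem hd'.1).trans hC2) (hpos d hd'.1) hd'.2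
    have hsum : ∀ k, CS.sum k = D.sum k + R.sum k := fun k => by
      rw [← hsplit, Multiset.sum_add, Pi.add_apply]
    have hRi : R.sum i = 0 := sum_apply_eq_zero fun d hd => (hRm d hd).2
    have hDk : ∀ k, k ≠ i → k ≠ j → D.sum k = 0 := fun k hki hkj =>
      sum_apply_eq_zero fun d hd => hD1 d hd k hki hkj
    have hsi := hsum i
    have hsj := hsum j
    have hci : CS.sum i ≤ c i := hC2 i
    have hcj : CS.sum j ≤ c j := hC2 j
    refine ⟨R, ⟨?_, ?_⟩, fun d hd => hpos d (hRm d hd).1, hle.trans ?_⟩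
    · intro d hd k hk
      by_cases hki : k = i
      · subst hki; exact (hRm d hd).2
      · exact hC1 d (hRm d hd).1 k fun hk' => hk (Finset.mem_erase.2 ⟨hki, hk'⟩)
    · intro k
      change R.sum k ≤ c k
      have : CS.sum k ≤ c k := hC2 k
      have := hsum k
      omega
    · have key := hh.le hij D (c i) hciK (c j - R.sum j) (by omega) hD1 (by omega) (by omega)
      have hval : (CS.map O).sum = (D.map O).sum + (R.map O).sum := by
        rw [← hsplit, Multiset.map_add, Multiset.sum_add]
      unfold score
      rw [sum_eq_add_erase_erase hi hj hij, ← Finset.add_sum_erase _ _ hjA, hgj _ (by omega), hval]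
      have : ∑ k ∈ (A.erase i).erase j, g' k (c k - R.sum k)
          = ∑ k ∈ (A.erase i).erase j, g k (c k - CS.sum k) := by
        refine Finset.sum_congr rfl fun k hk => ?_
        simp only [Finset.mem_erase] at hk
        rw [hsum, hDk k hk.2.1 hk.1, zero_add, hg k hk.2.2 hk.2.1 hk.1 _ (Nat.sub_le _ _)]
      rw [this, hsi, hRi, add_zero, show c j - CS.sum j = c j - R.sum j - D.sum j by omega]
      linarith

/-- Leftovers never exceed `c k`, so table entries beyond that are never read. -/
theorem IsOptimum.congr {O : (ℕ → ℕ) → ℝ} {c : ℕ → ℕ} {A : Finset ℕ}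
    {g g' : ℕ → ℕ → ℝ} {z : ℝ} (h : IsOptimum O c A g z)
    (hg : ∀ k ∈ A, ∀ a ≤ c k, g' k a = g k a) : IsOptimum O c A g' z := by
  have : ∀ CS, score O c A g' CS = score O c A g CS := fun CS => by
    unfold score
    rw [Finset.sum_congr rfl fun k hk => hg k hk _ (Nat.sub_le _ _)]
  obtain ⟨h1, h2⟩ := h
  exact ⟨by simpa only [this] using h1, by simpa only [this] using h2⟩

/-- When only an index of bound `0` is left, its table holds the optimum. -/
theorem IsOptimum.eq_of_singleton {O : (ℕ → ℕ) → ℝ} {c : ℕ → ℕ} {g : ℕ → ℕ → ℝ} {z : ℝ} {r : ℕ}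
    (hz : IsOptimum O c {r} g z) (hr : c r = 0) (hO : O 0 = 0) : g r 0 = z := by
  obtain ⟨hS, CS, ⟨hC1, hC2⟩, hpos, hle⟩ := hz
  apply le_antisymm
  · have := hS 0 ⟨by simp, by simp⟩
    simpa [score, hr] using this
  -- Bound `0` leaves only the zero vector, which has no positive value.
  · have : CS = 0 := by
      refine Multiset.eq_zero_of_forall_notMem fun d hd => ?_
      have h0 : d = 0 := by
        funext k
        by_cases hk : k = r
        · subst hk
          have h1 : d k ≤ CS.sum k := Multiset.le_sum_of_mem hd k
          have h2 : CS.sum k ≤ c k := hC2 k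
          rw [Pi.zero_apply]; omega
        · exact hC1 d hd k (by simpa using hk)
      have := hpos d hd
      rw [h0, hO] at this
      exact lt_irrefl _ this
    subst this
    simpa [score, hr] using hle

end MergeDP

/-! ### Games: the initial optimum and the isolation test -/

namespace OCFGame

variable {n : ℕ}

open MergeDP

/-- The value oracle on vectors indexed by all natural numbers, of which the first `n` entries
are read. -/
noncomputable def natOracle (G : OCFGame n) (d : ℕ → ℕ) : ℝ := G.oracle fun i : Fin n => d i

/-- A coalition as a vector indexed by all natural numbers. -/
def extend (G : OCFGame n) (c : G.Coalition) (k : ℕ) : ℕ := if h : k < n then c.1 ⟨k, h⟩ else 0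

theorem extend_fin (G : OCFGame n) (c : G.Coalition) (i : Fin n) : G.extend c i = c.1 i := by
  simp [extend]

theorem extend_of_le (G : OCFGame n) (c : G.Coalition) {k : ℕ} (h : n ≤ k) : G.extend c k = 0 := by
  simp [extend, h]

theorem natOracle_extend (G : OCFGame n) (c : G.Coalition) : G.natOracle (G.extend c) = G.v c := by
  have : (fun i : Fin n => G.extend c i) = c.1 := funext fun i => G.extend_fin c i
  unfold natOracle oracle
  rw [this]
  exact dif_pos c.2

theorem natOracle_zero (G : OCFGame n) : G.natOracle 0 = 0 := by
  unfold natOracle oracle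
  split_ifs with h
  · exact G.v_zero _ fun i => rfl
  · rfl

theorem oracle_pos (G : OCFGame n) {d : Fin n → ℕ} (h : 0 < G.oracle d) :
    ∃ hd : d ≤ G.W, 0 < G.v ⟨d, hd⟩ := by
  unfold oracle at h
  split_ifs at h with hd
  · exact ⟨hd, h⟩
  · exact absurd h (lt_irrefl _)

/-- The unused weight forms one further coalition `e` of nonnegative value, so structures of weight
at most `c` do no better than those of weight exactly `c`. -/
theorem le_superadditiveCover (G : OCFGame n) (c : G.Coalition) (CS : Multiset (ℕ → ℕ))
    (h : CS.sum ≤ G.extend c) : (CS.map G.natOracle).sum ≤ G.superadditiveCover c := by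
  classical
  -- The zero coalition is a default value that no member of `CS` meets, by `hle`.
  let f : (ℕ → ℕ) → G.Coalition := fun d =>
    if hd : (fun i : Fin n => d i) ≤ G.W then ⟨fun i => d i, hd⟩ else ⟨0, fun i => Nat.zero_le _⟩
  have hle : ∀ d ∈ CS, (fun i : Fin n => d i) ≤ G.W := fun d hd i =>
    calc d i ≤ CS.sum i := Multiset.le_sum_of_mem hd i
      _ ≤ G.extend c i := h i
      _ = c.1 i := G.extend_fin c i
      _ ≤ G.W i := c.2 i
  have hv : G.value (CS.map f) = (CS.map G.natOracle).sum := by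
    unfold value
    rw [Multiset.map_map]
    refine congrArg _ (Multiset.map_congr rfl fun d hd => ?_)
    simp only [Function.comp, f, dif_pos (hle d hd), natOracle, oracle]
  have hw : ∀ (D : Multiset (ℕ → ℕ)), (∀ d ∈ D, (fun i : Fin n => d i) ≤ G.W) →
      G.weight (D.map f) = fun i : Fin n => D.sum i := by
    intro D
    induction D using Multiset.induction_on with
    | empty => intro _; rfl
    | cons d D ih =>
      intro hD
      have h1 := ih fun e he => hD e (Multiset.mem_cons_of_mem he)
      have h2 := hD d (Multiset.mem_cons_self d D)
      unfold weight at h1 ⊢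
      funext i
      simp only [Multiset.map_cons, Multiset.sum_cons, h1, Pi.add_apply]
      simp only [f, dif_pos h2]
  have hwc : ∀ i : Fin n, CS.sum i ≤ c.1 i := fun i => (h i).trans (G.extend_fin c i).le
  let e : G.Coalition := ⟨fun i => c.1 i - CS.sum i, fun i => (Nat.sub_le _ _).trans (c.2 i)⟩
  have hwe : G.weight (e ::ₘ CS.map f) = c.1 := by
    have := hw CS hle
    unfold weight at this ⊢
    funext i
    rw [Multiset.map_cons, Multiset.sum_cons, this]
    exact Nat.sub_add_cancel (hwc i)
  have hmem : G.value (e ::ₘ CS.map f) ∈ G.valueSet c :=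
    ⟨_, by unfold IsCoalitionStructure; rw [hwe]; exact c.2, hwe, rfl⟩
  have := (G.isGreatest_superadditiveCover c).2 hmem
  rw [← hv]
  have he : G.value (e ::ₘ CS.map f) = G.v e + G.value (CS.map f) := by
    simp [value]
  linarith [G.v_nonneg e]

/-- With empty tables, the optimum is the value of the superadditive cover. -/
theorem isOptimum_superadditiveCover (G : OCFGame n) (c : G.Coalition) {g : ℕ → ℕ → ℝ}
    (hg : ∀ k ≤ n, ∀ a ≤ G.extend c k, g k a = 0) :
    IsOptimum G.natOracle (G.extend c) (Finset.range (n + 1)) g (G.superadditiveCover c) := by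
  classical
  have hscore : ∀ CS, score G.natOracle (G.extend c) (Finset.range (n + 1)) g CS
      = (CS.map G.natOracle).sum := fun CS => by
    unfold score
    rw [Finset.sum_eq_zero, add_zero]
    intro k hk
    exact hg k (by simpa [Nat.lt_succ_iff] using hk) _ (Nat.sub_le _ _)
  refine ⟨fun CS hCS => (hscore CS).trans_le (G.le_superadditiveCover c CS hCS.2), ?_⟩
  obtain ⟨CS, -, hw, hv⟩ := (G.isGreatest_superadditiveCover c).1
  -- Dropping worthless coalitions keeps the value and only lowers the weight; `IsOptimum` asks for
  -- a witness with positive members.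
  let D := CS.filter fun d => 0 < G.v d
  have hsum : ∀ (E : Multiset G.Coalition) (k : ℕ),
      (E.map G.extend).sum k = if h : k < n then G.weight E ⟨k, h⟩ else 0 := by
    intro E k
    induction E using Multiset.induction_on with
    | empty => simp [weight]
    | cons d E ih =>
      rw [Multiset.map_cons, Multiset.sum_cons, Pi.add_apply, ih]
      by_cases hk : k < n <;> simp [extend, hk, weight]
  have hDw : ∀ i, G.weight D i ≤ c.1 i := by
    intro i
    have h2 : CS.filter (fun d => 0 < G.v d) + CS.filter (fun d => ¬ 0 < G.v d) = CS :=
      Multiset.filter_add_not _ CS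
    rw [← hw, ← h2]
    simp [weight, D]
  have hDv : (D.map G.v).sum = (CS.map G.v).sum := by
    have h2 : CS.filter (fun d => 0 < G.v d) + CS.filter (fun d => ¬ 0 < G.v d) = CS :=
      Multiset.filter_add_not _ CS
    conv_rhs => rw [← h2, Multiset.map_add, Multiset.sum_add]
    rw [Multiset.sum_eq_zero (s := Multiset.map G.v (Multiset.filter (fun d => ¬ 0 < G.v d) CS)),
      add_zero]
    intro x hx
    obtain ⟨d, hd, rfl⟩ := Multiset.mem_map.1 hx
    exact le_antisymm (not_lt.1 (Multiset.mem_filter.1 hd).2) (G.v_nonneg d)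
  refine ⟨D.map G.extend, ⟨?_, ?_⟩, ?_, ?_⟩
  · intro d hd k hk
    obtain ⟨e, -, rfl⟩ := Multiset.mem_map.1 hd
    exact G.extend_of_le e (by simp at hk; omega)
  · intro k
    rw [hsum]
    unfold extend
    split_ifs with h
    · exact hDw _
    · exact le_rfl
  · intro d hd
    obtain ⟨e, he, rfl⟩ := Multiset.mem_map.1 hd
    rw [natOracle_extend]
    exact (Multiset.mem_filter.1 he).2
  · rw [hscore, ← hv, Multiset.map_map]
    refine le_of_eq ?_
    unfold value
    rw [← hDv]
    exact congrArg _ (Multiset.map_congr rfl fun d _ => (G.natOracle_extend d).symm)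

/-- In a `2`-OCF game the vectors of positive value use at most two agents. -/
theorem IsKOCF.eq_pairVec {G : OCFGame n} (hG : G.IsKOCF 2) {d : ℕ → ℕ} (hd : 0 < G.natOracle d)
    {i k : ℕ} (hi : i < n) (hk : k < n) (hik : i ≠ k) (hdi : d i ≠ 0) (hdk : d k ≠ 0) :
    G.natOracle d = G.natOracle (pairVec i (d i) k (d k)) := by
  obtain ⟨hW, hv⟩ := G.oracle_pos hd
  have hcard : (G.supp ⟨_, hW⟩).card ≤ 2 := by
    by_contra h
    exact hv.ne' (hG _ (not_le.1 h))
  unfold natOracle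
  refine congrArg _ (funext fun l => ?_)
  by_cases hli : (l : ℕ) = i
  · rw [hli, pairVec_left hik]
  by_cases hlk : (l : ℕ) = k
  · rw [hlk, pairVec_right]
  rw [pairVec_other hli hlk]
  by_contra hl
  have hsub : ({⟨i, hi⟩, ⟨k, hk⟩, l} : Finset (Fin n)) ⊆ G.supp ⟨_, hW⟩ := by
    intro m hm
    simp only [Finset.mem_insert, Finset.mem_singleton] at hm
    simp only [supp, Finset.mem_filter, Finset.mem_univ, true_and]
    rcases hm with rfl | rfl | rfl <;> exact Nat.pos_of_ne_zero (by assumption)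
  have h3 : ({⟨i, hi⟩, ⟨k, hk⟩, l} : Finset (Fin n)).card = 3 := by
    rw [Finset.card_eq_three]
    refine ⟨_, _, _, ?_, ?_, ?_, rfl⟩
    · simpa [Fin.ext_iff] using hik
    · intro h; exact hli (by rw [← h])
    · intro h; exact hlk (by rw [← h])
  have := Finset.card_le_card hsub
  omega

/-- Two agents with a coalition of positive value are adjacent in the interaction tree. -/
theorem adj_of_natOracle_pos {G : OCFGame n} {T : SimpleGraph (Fin n)} (hT : G.restrict T = G)
    {i k p q : ℕ} (hi : i < n) (hk : k < n) (hik : i ≠ k) (hp : 0 < p) (hq : 0 < q)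
    (h : 0 < G.natOracle (pairVec i p k q)) : T.Adj ⟨i, hi⟩ ⟨k, hk⟩ := by
  classical
  obtain ⟨hW, hv⟩ := G.oracle_pos h
  set d : G.Coalition := ⟨_, hW⟩ with hd
  -- The type of coalitions depends on the game, so the equality of games is applied through a
  -- variable `H`.
  have hvr : ∀ (H : OCFGame n) (e : Fin n → ℕ) (h1 : e ≤ G.W) (h2 : e ≤ H.W), H = G →
      H.v ⟨e, h2⟩ = G.v ⟨e, h1⟩ := by
    rintro H e h1 h2 rfl; rfl
  have hr := hvr (G.restrict T) _ hW hW hT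
  have hconn : (T.induce (G.supp d : Set (Fin n))).Connected := by
    by_contra hc
    have : (G.restrict T).v ⟨_, hW⟩ = 0 := if_neg hc
    rw [hr] at this
    exact hv.ne' this
  have hmem : ∀ m : Fin n, m ∈ G.supp d ↔ (m = ⟨i, hi⟩ ∨ m = ⟨k, hk⟩) := by
    intro m
    simp only [supp, Finset.mem_filter, Finset.mem_univ, true_and, hd, Fin.ext_iff]
    constructor
    · intro hm
      by_contra hne
      push Not at hne
      rw [pairVec_other hne.1 hne.2] at hm
      exact lt_irrefl _ hm
    · rintro (hm | hm)
      · rw [hm, pairVec_left hik]; exact hp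
      · rw [hm, pairVec_right]; exact hq
  let a : (G.supp d : Set (Fin n)) := ⟨⟨i, hi⟩, (hmem _).2 (Or.inl rfl)⟩
  let b : (G.supp d : Set (Fin n)) := ⟨⟨k, hk⟩, (hmem _).2 (Or.inr rfl)⟩
  have hab : a ≠ b := by
    intro h; exact hik (congrArg (fun x => (x.1 : ℕ)) h)
  have : Nontrivial (G.supp d : Set (Fin n)) := ⟨a, b, hab⟩
  -- The support has two elements, so a neighbour of `i` within it can only be `k`.
  obtain ⟨w, hw⟩ := hconn.preconnected.exists_adj_of_nontrivial a
  have hadj : T.Adj a.1 w.1 := by simpa using hw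
  rcases (hmem w.1).1 w.2 with h1 | h1
  · rw [h1] at hadj; exact absurd hadj (T.loopless.irrefl _)
  · rw [h1] at hadj; exact hadj

/-- The agents `i` and `j` pass the isolation test: no other remaining agent has a valuable
coalition with `i`. -/
def IsIsolated (G : OCFGame n) (K : ℕ) (A : Finset ℕ) (i j : ℕ) : Prop :=
  ∀ k < n, k ∈ A → k ≠ i → k ≠ j → ∀ p < K, ∀ q < K, 0 < p → 0 < q →
    G.natOracle (pairVec i p k q) ≤ 0

/-- As long as an agent is left, some pair passes the isolation test. -/
theorem exists_isIsolated {G : OCFGame n} (hG : G.HasTreeInteraction) (K : ℕ) {A : Finset ℕ}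
    (hA : A ⊆ Finset.range (n + 1)) (hn : n ∈ A) (hne : A ≠ {n}) :
    ∃ i < n, ∃ j ≤ n, i ∈ A ∧ j ∈ A ∧ i ≠ j ∧ G.IsIsolated K A i j := by
  obtain ⟨T, hT, hr⟩ := hG
  obtain ⟨a, ha, han⟩ : ∃ a ∈ A, a ≠ n := by
    by_contra h
    push Not at h
    exact hne (Finset.eq_singleton_iff_unique_mem.2 ⟨hn, h⟩)
  have hlt : ∀ b ∈ A, b ≠ n → b < n := fun b hb hbn => by
    have := Finset.mem_range.1 (hA hb); omega
  obtain ⟨i, hi, hiu⟩ := hT.isAcyclic.exists_subsingleton_neighbors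
    (S := {x : Fin n | (x : ℕ) ∈ A}) ⟨⟨a, hlt a ha han⟩, ha⟩
  by_cases hex : ∃ j : Fin n, (j : ℕ) ∈ A ∧ T.Adj i j
  · obtain ⟨j, hj, hij⟩ := hex
    refine ⟨i, i.2, j, j.2.le, hi, hj, ?_, ?_⟩
    · intro h; exact hij.ne (Fin.ext h)
    · intro k hk hkA hki hkj p _ q _ hp hq
      by_contra h
      have := adj_of_natOracle_pos hr i.2 hk (Ne.symm hki) hp hq (not_le.1 h)
      have h' := hiu ⟨k, hk⟩ hkA j hj this hij
      exact hkj (congrArg Fin.val h')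
  -- Without a remaining neighbour, `i` is merged into the extra index `n`.
  · refine ⟨i, i.2, n, le_rfl, hi, hn, i.2.ne, ?_⟩
    intro k hk hkA hki hkj p _ q _ hp hq
    by_contra h
    exact hex ⟨⟨k, hk⟩, hkA, adj_of_natOracle_pos hr i.2 hk (Ne.symm hki) hp hq (not_le.1 h)⟩

/-- A merge along a pair that passes the isolation test preserves the optimum. -/
theorem isOptimum_merge {G : OCFGame n} (hG : G.IsKOCF 2) {c : G.Coalition} {A : Finset ℕ}
    {g g' : ℕ → ℕ → ℝ} {z : ℝ} {i j K : ℕ} {h : ℕ → ℕ → ℝ}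
    (hz : IsOptimum G.natOracle (G.extend c) A g z) (hin : i < n) (hi : i ∈ A) (hj : j ∈ A)
    (hij : i ≠ j) (hK : ∀ k, G.extend c k < K) (iso : G.IsIsolated K A i j)
    (hh : IsMerge (g i) (g j) (fun p q => G.natOracle (pairVec i p j q)) K h)
    (hgj : ∀ y < K, g' j y = h (G.extend c i) y)
    (hg : ∀ k ∈ A, k ≠ i → k ≠ j → ∀ y < K, g' k y = g k y) :
    IsOptimum G.natOracle (G.extend c) (A.erase i) g' z := by
  refine hz.merge hi hj hij (hK i) (hK j) ?_ hh (fun y hy => hgj y (hy.trans_lt (hK j)))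
    fun k hk hki hkj y hy => hg k hk hki hkj y (hy.trans_lt (hK k))
  intro d hd hdc hpos hdi k hki hkj
  by_contra hdk
  have hkA : k ∈ A := by
    by_contra h; exact hdk (hd k h)
  have hkn : k < n := by
    by_contra h
    have := hdc k
    rw [G.extend_of_le c (not_lt.1 h)] at this
    exact hdk (Nat.le_zero.1 this)
  -- Two nonzero entries already exhaust the support, so `d` has the value of a bundle that the test
  -- has queried.
  have h1 := hG.eq_pairVec hpos hin hkn (Ne.symm hki) hdi hdk
  have h2 := iso k hkn hkA hki hkj (d i) ((hdc i).trans_lt (hK i)) (d k) ((hdc k).trans_lt (hK k))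
    (Nat.pos_of_ne_zero hdi) (Nat.pos_of_ne_zero hdk)
  rw [← h1] at h2
  exact absurd hpos (not_lt.2 h2)

end OCFGame

/-! ### Structured programs and their compilation -/

/-- The data of a configuration apart from the program counter. -/
structure Store where
  reg : ℕ → ℕ
  mem : ℕ → ℕ
  val : ℕ → ℝ

/-- The configuration with a given program counter and given data. -/
def Store.at (s : Store) (pc : ℕ) : Config := ⟨pc, s.reg, s.mem, s.val⟩

namespace Instr

variable {n : ℕ}

/-- The effect of one instruction on the data. -/
noncomputable def act (G : OCFGame n) (s : Store) : Instr → Store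
  | .const r k => { s with reg := Function.update s.reg r k }
  | .add r a b => { s with reg := Function.update s.reg r (s.reg a + s.reg b) }
  | .sub r a b => { s with reg := Function.update s.reg r (s.reg a - s.reg b) }
  | .load r a => { s with reg := Function.update s.reg r (s.mem (s.reg a)) }
  | .store a b => { s with mem := Function.update s.mem (s.reg a) (s.reg b) }
  | .vcopy a b => { s with val := Function.update s.val (s.reg a) (s.val (s.reg b)) }
  | .vadd a b c =>
      { s with val := Function.update s.val (s.reg a) (s.val (s.reg b) + s.val (s.reg c)) }
  | .query a b =>
      { s with
        val := Function.update s.val (s.reg a)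
          (G.oracle (fun i : Fin n => s.mem (s.reg b + i))) }
  | .jlt _ _ _ => s
  | .vjle _ _ _ => s

/-- The instruction is not a jump. -/
def isPlain : Instr → Bool
  | .jlt _ _ _ => false
  | .vjle _ _ _ => false
  | _ => true

/-- The registers written by an instruction. -/
def target : Instr → List ℕ
  | .const r _ => [r]
  | .add r _ _ => [r]
  | .sub r _ _ => [r]
  | .load r _ => [r]
  | _ => []

theorem exec_at (G : OCFGame n) (s : Store) (pc : ℕ) (i : Instr) (h : i.isPlain) :
    i.exec G (s.at pc) = (i.act G s).at (pc + 1) := by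
  cases i <;> first | rfl | simp [isPlain] at h

theorem act_reg (G : OCFGame n) (s : Store) (i : Instr) {r : ℕ} (h : r ∉ i.target) :
    (i.act G s).reg r = s.reg r := by
  cases i <;> simp_all [target, act]

end Instr

/-- Structured programs. `loop r l c` runs `c` with register `r` counting from `0` up to the
content of register `l`; register `1` must hold `1`. -/
inductive Cmd : Type
  | skip
  | prim (i : Instr)
  | seq (c d : Cmd)
  | ite (a b : ℕ) (c d : Cmd)
  | vite (a b : ℕ) (c d : Cmd)
  | loop (r l : ℕ) (c : Cmd)

namespace Cmd

variable {n : ℕ}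

/-- Sequential composition of a list of instructions, followed by a program. -/
def prims (l : List Instr) (c : Cmd) : Cmd := l.foldr (fun i d => seq (prim i) d) c

/-- Set the register `r` to `k`. -/
def setReg (s : Store) (r k : ℕ) : Store := { s with reg := Function.update s.reg r k }

/-- Iterate `f`, with register `r` counting up. -/
def iter (f : Store → Store) (r : ℕ) : ℕ → Store → Store
  | 0, s => setReg s r 0
  | k + 1, s => setReg (f (iter f r k s)) r (k + 1)

open Classical in
/-- The effect of a structured program. -/
noncomputable def eval (G : OCFGame n) : Cmd → Store → Store
  | skip, s => s
  | prim i, s => i.act G s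
  | seq c d, s => eval G d (eval G c s)
  | ite a b c d, s => if s.reg a < s.reg b then eval G c s else eval G d s
  | vite a b c d, s => if s.val (s.reg a) ≤ s.val (s.reg b) then eval G c s else eval G d s
  | loop r l c, s => iter (eval G c) r (s.reg l) s

/-- The number of instructions of the compiled program. -/
def size : Cmd → ℕ
  | skip => 0
  | prim _ => 1
  | seq c d => size c + size d
  | ite _ _ c d => size c + size d + 2
  | vite _ _ c d => size c + size d + 2
  | loop _ _ c => size c + 5

/-- The compiled program, to be placed at position `o`. -/
def code : Cmd → ℕ → Program
  | skip, _ => []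
  | prim i, _ => [i]
  | seq c d, o => code c o ++ code d (o + size c)
  | ite a b c d, o =>
      [.jlt a b (o + size d + 2)] ++ code d (o + 1) ++ [.vjle 0 0 (o + size c + size d + 2)]
        ++ code c (o + size d + 2)
  | vite a b c d, o =>
      [.vjle a b (o + size d + 2)] ++ code d (o + 1) ++ [.vjle 0 0 (o + size c + size d + 2)]
        ++ code c (o + size d + 2)
  | loop r l c, o =>
      [.const r 0, .jlt r l (o + 3), .vjle 0 0 (o + size c + 5)] ++ code c (o + 3)
        ++ [.add r r 1, .vjle 0 0 (o + 1)]

/-- The registers written by a structured program. -/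
def targets : Cmd → List ℕ
  | skip => []
  | prim i => i.target
  | seq c d => targets c ++ targets d
  | ite _ _ c d => targets c ++ targets d
  | vite _ _ c d => targets c ++ targets d
  | loop r _ c => r :: targets c

/-- Well-formed programs: plain instructions, loop counters that are only written by the loop,
and loop limits in the protected registers `L`, which are never written. -/
def WF (L : List ℕ) : Cmd → Bool
  | skip => true
  | prim i => i.isPlain && i.target.all (fun r => !L.contains r)
  | seq c d => WF L c && WF L d
  | ite _ _ c d => WF L c && WF L d
  | vite _ _ c d => WF L c && WF L d
  | loop r l c => WF L c && !L.contains r && L.contains l && L.contains 1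
      && !(targets c).contains r

/-- A bound on the running time, if `B` bounds the loop limits and the cost of instructions. -/
def time {R : Type*} [CommSemiring R] (B : R) : Cmd → R
  | skip => 0
  | prim _ => B
  | seq c d => time B c + time B d
  | ite _ _ c d => time B c + time B d + 2
  | vite _ _ c d => time B c + time B d + 2
  | loop _ _ c => B * (time B c + 3) + 3

/-- `time` is defined over any commutative semiring so that one recursion gives both the polynomial
and its numerical values. -/
theorem map_time {R S : Type*} [CommSemiring R] [CommSemiring S] (f : R →+* S) (B : R) (c : Cmd) :
    f (time B c) = time (f B) c := by
  have h2 : f 2 = 2 := map_ofNat f 2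
  have h3 : f 3 = 3 := map_ofNat f 3
  induction c <;> simp_all [time]

theorem time_mono {B B' : ℕ} (h : B ≤ B') (c : Cmd) : time B c ≤ time B' c := by
  induction c <;> simp only [time] <;> gcongr

theorem length_code (c : Cmd) (o : ℕ) : (code c o).length = size c := by
  induction c generalizing o <;> simp_all [code, size] <;> omega

/-- The frame rule: concrete programs have computable target lists, so its side condition is settled
by `decide`. -/
theorem eval_reg (G : OCFGame n) (c : Cmd) (s : Store) {r : ℕ} (h : r ∉ c.targets) :
    (eval G c s).reg r = s.reg r := by
  induction c generalizing s with
  | skip => rfl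
  | prim i => exact i.act_reg G s h
  | seq c d hc hd =>
    simp only [targets, List.mem_append, not_or] at h
    rw [eval, hd _ h.2, hc _ h.1]
  | ite a b c d hc hd =>
    simp only [targets, List.mem_append, not_or] at h
    rw [eval]
    split_ifs
    · exact hc _ h.1
    · exact hd _ h.2
  | vite a b c d hc hd =>
    simp only [targets, List.mem_append, not_or] at h
    rw [eval]
    split_ifs
    · exact hc _ h.1
    · exact hd _ h.2
  | loop r' l c hc =>
    simp only [targets, List.mem_cons, not_or] at h
    rw [eval]
    generalize s.reg l = N
    induction N with
    | zero => simp [iter, setReg, h.1]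
    | succ N ih =>
      simp only [iter, setReg]
      rw [Function.update_of_ne h.1, hc _ h.2, ih]

/-- The compiled loop rereads its limit in every round, whereas `eval` reads it once; they agree
because limits are protected. -/
theorem WF.not_mem_targets {L : List ℕ} {c : Cmd} (h : c.WF L) {r : ℕ} (hr : r ∈ L) :
    r ∉ c.targets := by
  induction c with
  | skip => simp [targets]
  | prim i =>
    simp only [WF, Bool.and_eq_true, List.all_eq_true] at h
    intro hi
    simpa [hr] using h.2 r hi
  | seq c d hc hd | ite a b c d hc hd | vite a b c d hc hd =>
    simp only [WF, Bool.and_eq_true] at h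
    simp [targets, hc h.1, hd h.2]
  | loop r' l c hc =>
    simp only [WF, Bool.and_eq_true, Bool.not_eq_true', List.contains_eq_mem, decide_eq_true_eq,
      decide_eq_false_iff_not] at h
    simp only [targets, List.mem_cons, not_or]
    refine ⟨?_, hc h.1.1.1.1⟩
    rintro rfl
    exact h.1.1.1.2 hr

/-! ### Correctness and running time of compiled code -/

/-- `l` occurs in the program `P` at position `o`. -/
def OccursAt (P : Program) (o : ℕ) (l : Program) : Prop := ∀ k < l.length, P[o + k]? = l[k]?

theorem OccursAt.left {P : Program} {o : ℕ} {l l' : Program} (h : OccursAt P o (l ++ l')) :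
    OccursAt P o l := fun k hk => by
  rw [h k (by rw [List.length_append]; omega), List.getElem?_append_left hk]

theorem OccursAt.right {P : Program} {o m : ℕ} {l l' : Program} (h : OccursAt P o (l ++ l'))
    (hm : m = o + l.length) : OccursAt P m l' := fun k hk => by
  subst hm
  rw [Nat.add_assoc, h _ (by rw [List.length_append]; omega),
    List.getElem?_append_right (Nat.le_add_right _ _), Nat.add_sub_cancel_left]

theorem OccursAt.head {P : Program} {o : ℕ} {i : Instr} {l : Program}
    (h : OccursAt P o (i :: l)) : P[o]? = some i := by
  simpa using h 0 (by simp)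

theorem OccursAt.tail {P : Program} {o : ℕ} {i : Instr} {l : Program}
    (h : OccursAt P o (i :: l)) : OccursAt P (o + 1) l :=
  OccursAt.right (l := [i]) (by simpa using h) (by simp)

/-- A value is at most itself, so `vjle 0 0` is an unconditional jump. -/
theorem run_jump {P : Program} {G : OCFGame n} {s : Store} {o l t : ℕ} {s' : Config}
    (h : P[o]? = some (.vjle 0 0 l)) (hr : Run P G (s.at l) t s') :
    Run P G (s.at o) (1 + t) s' := by
  refine Run.step (s.at o) _ t s' h ?_
  have : (Instr.vjle 0 0 l).exec G (s.at o) = s.at l := by simp [Instr.exec, Store.at]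
  rwa [this]

theorem run_jlt {P : Program} {G : OCFGame n} {s : Store} {o a b l t : ℕ} {s' : Config}
    (h : P[o]? = some (.jlt a b l))
    (hr : Run P G (s.at (if s.reg a < s.reg b then l else o + 1)) t s') :
    Run P G (s.at o) (1 + t) s' :=
  Run.step (s.at o) _ t s' h hr

open Classical in
theorem run_vjle {P : Program} {G : OCFGame n} {s : Store} {o a b l t : ℕ} {s' : Config}
    (h : P[o]? = some (.vjle a b l))
    (hr : Run P G (s.at (if s.val (s.reg a) ≤ s.val (s.reg b) then l else o + 1)) t s') :
    Run P G (s.at o) (1 + t) s' :=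
  Run.step (s.at o) _ t s' h hr

theorem run_plain {P : Program} {G : OCFGame n} {s : Store} {o t : ℕ} {i : Instr} {s' : Config}
    (hi : i.isPlain) (h : P[o]? = some i) (hr : Run P G ((i.act G s).at (o + 1)) t s') :
    Run P G (s.at o) (i.cost n + t) s' := by
  refine Run.step (s.at o) _ t s' h ?_
  rwa [Instr.exec_at G s o i hi]

theorem cost_le {B : ℕ} (hB : n + 1 ≤ B) (i : Instr) : i.cost n ≤ B := by
  cases i <;> simp only [Instr.cost] <;> omega

/-- The compiled program runs as described by `eval` and `time`. -/
theorem run_code {P : Program} {G : OCFGame n} {L : List ℕ} {B : ℕ} (hB : n + 1 ≤ B) (c : Cmd) :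
    ∀ (o : ℕ) (s : Store), c.WF L → (∀ r ∈ L, s.reg r ≤ B) → s.reg 1 = 1 ∨ 1 ∉ L →
      OccursAt P o (code c o) → ∃ t ≤ time B c, ∀ t' s',
        Run P G ((eval G c s).at (o + size c)) t' s' → Run P G (s.at o) (t + t') s' := by
  -- A `Run` always ends in a halting configuration, so a code fragment is described by how it
  -- prolongs any run that follows it.
  induction c with
  | skip =>
    intro o s _ _ _ _
    exact ⟨0, Nat.zero_le _, fun t' s' h => by simpa [eval, size] using h⟩
  | prim i =>
    intro o s hw _ _ hP
    simp only [WF, Bool.and_eq_true] at hw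
    exact ⟨i.cost n, cost_le hB i, fun t' s' h => run_plain hw.1 hP.head h⟩
  | seq c d hc hd =>
    intro o s hw hL h1 hP
    simp only [WF, Bool.and_eq_true] at hw
    obtain ⟨t1, ht1, hr1⟩ := hc o s hw.1 hL h1 hP.left
    obtain ⟨t2, ht2, hr2⟩ := hd (o + size c) (eval G c s) hw.2
      (fun r hr => by rw [eval_reg G c s (WF.not_mem_targets hw.1 hr)]; exact hL r hr)
      (by
        by_cases h : 1 ∈ L
        · left; rw [eval_reg G c s (WF.not_mem_targets hw.1 h)]; exact h1.resolve_right (by simpa)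
        · exact Or.inr h)
      (hP.right (by rw [length_code]))
    refine ⟨t1 + t2, by simp only [time]; omega, fun t' s' h => ?_⟩
    rw [Nat.add_assoc]
    refine hr1 _ _ (hr2 _ _ ?_)
    rw [Nat.add_assoc]
    exact h
  | ite a b c d hc hd =>
    intro o s hw hL h1 hP
    simp only [WF, Bool.and_eq_true] at hw
    rw [code] at hP
    obtain ⟨tc, htc, hrc⟩ := hc (o + size d + 2) s hw.1 hL h1
      (hP.right (by simp [length_code]; omega))
    obtain ⟨td, htd, hrd⟩ := hd (o + 1) s hw.2 hL h1 (hP.left.left.right (by simp))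
    have hj := hP.left.left.left.head
    have hk := (hP.left.right (m := o + 1 + size d) (by simp [length_code]; omega)).head
    by_cases hab : s.reg a < s.reg b
    · refine ⟨1 + tc, by simp only [time]; omega, fun t' s' h => ?_⟩
      rw [Nat.add_assoc]
      refine run_jlt hj ?_
      rw [if_pos hab]
      refine hrc _ _ ?_
      rw [eval, if_pos hab, size] at h
      convert h using 2
      omega
    · refine ⟨1 + (td + 1), by simp only [time]; omega, fun t' s' h => ?_⟩
      rw [Nat.add_assoc, Nat.add_assoc]
      refine run_jlt hj ?_
      rw [if_neg hab]
      refine hrd _ _ (run_jump hk ?_)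
      rw [eval, if_neg hab, size] at h
      convert h using 2
      omega
  | vite a b c d hc hd =>
    intro o s hw hL h1 hP
    simp only [WF, Bool.and_eq_true] at hw
    rw [code] at hP
    obtain ⟨tc, htc, hrc⟩ := hc (o + size d + 2) s hw.1 hL h1
      (hP.right (by simp [length_code]; omega))
    obtain ⟨td, htd, hrd⟩ := hd (o + 1) s hw.2 hL h1 (hP.left.left.right (by simp))
    have hj := hP.left.left.left.head
    have hk := (hP.left.right (m := o + 1 + size d) (by simp [length_code]; omega)).head
    by_cases hab : s.val (s.reg a) ≤ s.val (s.reg b)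
    · refine ⟨1 + tc, by simp only [time]; omega, fun t' s' h => ?_⟩
      rw [Nat.add_assoc]
      refine run_vjle hj ?_
      rw [if_pos hab]
      refine hrc _ _ ?_
      rw [eval, if_pos hab, size] at h
      convert h using 2
      omega
    · refine ⟨1 + (td + 1), by simp only [time]; omega, fun t' s' h => ?_⟩
      rw [Nat.add_assoc, Nat.add_assoc]
      refine run_vjle hj ?_
      rw [if_neg hab]
      refine hrd _ _ (run_jump hk ?_)
      rw [eval, if_neg hab, size] at h
      convert h using 2
      omega
  | loop r l c hc =>
    intro o s hw hL h1 hP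
    have hwl := hw
    simp only [WF, Bool.and_eq_true, Bool.not_eq_true', List.contains_eq_mem, decide_eq_true_eq,
      decide_eq_false_iff_not] at hw
    obtain ⟨⟨⟨⟨hwc, hrL⟩, hlL⟩, h1L⟩, hrc⟩ := hw
    have hs1 : s.reg 1 = 1 := h1.resolve_right (by simpa)
    rw [code] at hP
    have hbody : OccursAt P (o + 3) (code c (o + 3)) := hP.left.right (by simp)
    have hconst := hP.left.left.head
    have hjlt := hP.left.left.tail.head
    have hexit := hP.left.left.tail.tail.head
    have hend := hP.right (m := o + 3 + size c) (by simp [length_code]; omega)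
    have hadd := hend.head
    have hback := hend.tail.head
    have hreg : ∀ k, ∀ m ∈ L, (iter (eval G c) r k s).reg m = s.reg m := by
      intro k m hm
      have hmr : m ≠ r := by rintro rfl; exact hrL hm
      induction k with
      | zero => simp [iter, setReg, hmr]
      | succ k ih =>
        simp only [iter, setReg]
        rw [Function.update_of_ne hmr, eval_reg G c _ (WF.not_mem_targets hwc hm), ih]
    have hcount : ∀ k, (iter (eval G c) r k s).reg r = k := by
      intro k
      cases k <;> simp [iter, setReg]
    -- Here `m` counts the rounds to come. A round adds the test, the increment and the jump back to
    -- its body; the last `2` are the failed test and the exit jump.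
    have hloop : ∀ m k, m + k = s.reg l → ∃ t ≤ m * (time B c + 3) + 2, ∀ t' s',
        Run P G ((eval G (loop r l c) s).at (o + size (loop r l c))) t' s' →
          Run P G ((iter (eval G c) r k s).at (o + 1)) (t + t') s' := by
      intro m
      induction m with
      | zero =>
        intro k hk
        refine ⟨1 + 1, by omega, fun t' s' h => ?_⟩
        rw [Nat.add_assoc]
        refine run_jlt hjlt ?_
        rw [if_neg (by rw [hcount, hreg k l hlL]; omega)]
        refine run_jump hexit ?_
        rw [eval, ← hk, Nat.zero_add] at h
        exact h
      | succ m ih =>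
        intro k hk
        obtain ⟨t2, ht2, hr2⟩ := ih (k + 1) (by omega)
        obtain ⟨t1, ht1, hr1⟩ := hc (o + 3) (iter (eval G c) r k s) hwc
          (fun m hm => by rw [hreg k m hm]; exact hL m hm)
          (Or.inl (by rw [hreg k 1 h1L]; exact hs1)) hbody
        refine ⟨1 + (t1 + (1 + (1 + t2))), ?_, fun t' s' h => ?_⟩
        · rw [Nat.succ_mul]; omega
        simp only [Nat.add_assoc]
        refine run_jlt hjlt ?_
        rw [if_pos (by rw [hcount, hreg k l hlL]; omega)]
        refine hr1 _ _ (run_plain (i := .add r r 1) rfl hadd (run_jump hback ?_))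
        have he : Instr.act G (eval G c (iter (eval G c) r k s)) (.add r r 1)
            = iter (eval G c) r (k + 1) s := by
          simp only [Instr.act, iter, setReg]
          rw [eval_reg G c _ hrc, hcount, eval_reg G c _ (WF.not_mem_targets hwc h1L),
            hreg k 1 h1L, hs1]
        rw [he]
        exact hr2 _ _ h
    obtain ⟨t, ht, hr⟩ := hloop (s.reg l) 0 (by omega)
    refine ⟨1 + t, ?_, fun t' s' h => ?_⟩
    · simp only [time]
      have := Nat.mul_le_mul_right (time B c + 3) (hL l hlL)
      omega
    rw [Nat.add_assoc]
    exact run_plain (i := .const r 0) rfl hconst (hr _ _ h)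

/-- The invariant rule for loops. -/
theorem loop_induction {G : OCFGame n} {r l : ℕ} {c : Cmd} (I : ℕ → Store → Prop) {s : Store}
    (h0 : I 0 (setReg s r 0))
    (hstep : ∀ k < s.reg l, ∀ s', (∀ m, m ≠ r → m ∉ c.targets → s'.reg m = s.reg m) →
      s'.reg r = k → I k s' → I (k + 1) (setReg (eval G c s') r (k + 1))) :
    I (s.reg l) (eval G (loop r l c) s) := by
  rw [eval]
  have : ∀ k ≤ s.reg l, I k (iter (eval G c) r k s) ∧
      (∀ m, m ≠ r → m ∉ c.targets → (iter (eval G c) r k s).reg m = s.reg m) ∧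
      (iter (eval G c) r k s).reg r = k := by
    intro k
    induction k with
    | zero =>
      intro _
      exact ⟨h0, fun m hm _ => by simp [iter, setReg, hm], by simp [iter, setReg]⟩
    | succ k ih =>
      intro hk
      obtain ⟨h1, h2, h3⟩ := ih (by omega)
      refine ⟨hstep k (by omega) _ h2 h3 h1, fun m hm hmc => ?_, by simp [iter, setReg]⟩
      simp only [iter, setReg]
      rw [Function.update_of_ne hm, eval_reg G c _ hmc, h2 m hm hmc]
  exact (this _ le_rfl).1

end Cmd

/-! ### The program and its arithmetic -/

namespace Cmd

variable {n : ℕ}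

/-- `reg r := reg x * reg 2`, if `reg x ≤ reg 2`. -/
def mul (r x : ℕ) : Cmd :=
  seq (prim (.const r 0)) (loop 18 2 (ite 18 x (prim (.add r r 2)) skip))

/-- The address `K + k * K + a` of the table entry `g k a`. -/
def gAddr (r k a : ℕ) : Cmd := seq (mul r k) (prims [.add r r 2, .add r r a] skip)

/-- The address `K + K * K + x * K + y` of the table entry `h x y`. -/
def hAddr (r x y : ℕ) : Cmd := seq (mul r x) (prims [.add r r 6, .add r r y] skip)

/-- Query the vector with entries `reg p` at `reg i` and `reg q` at `reg j`. -/
def queryPair (i p j q : ℕ) : Cmd :=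
  prims [.add 19 8 i, .store 19 p, .add 20 8 j, .store 20 q, .query 4 8, .store 19 5,
    .store 20 5] skip

theorem eval_prims (G : OCFGame n) (l : List Instr) (c : Cmd) (s : Store) :
    eval G (prims l c) s = eval G c (l.foldl (fun s i => i.act G s) s) := by
  induction l generalizing s with
  | nil => rfl
  | cons i l ih => exact ih _

/-- The loop runs `K` times, since its limit has to be a protected register, and adds `K` only while
the counter is below `reg x`. This is why `reg x ≤ reg 2` is needed. -/
theorem eval_mul (G : OCFGame n) {r x : ℕ} (s : Store) (h : s.reg x ≤ s.reg 2) (hr : r ≠ 18)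
    (hrx : r ≠ x) (hr2 : r ≠ 2) (hx : x ≠ 18) :
    eval G (mul r x) s = { s with
      reg := Function.update (Function.update s.reg r (s.reg x * s.reg 2)) 18 (s.reg 2) } := by
  have key : ∀ k, iter (eval G (ite 18 x (prim (.add r r 2)) skip)) 18 k
      { s with reg := Function.update s.reg r 0 } = { s with
      reg := Function.update (Function.update s.reg r (min k (s.reg x) * s.reg 2)) 18 k } := by
    intro k
    induction k with
    | zero => simp [iter, setReg]
    | succ k ih =>
      rw [iter, ih]
      simp only [eval, Instr.act, setReg, Function.update_self, Function.update_of_ne hrx.symm,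
        Function.update_of_ne hx, Function.update_of_ne hr, Function.update_of_ne hr2.symm,
        Function.update_of_ne (show (2 : ℕ) ≠ 18 by decide)]
      split_ifs with hk
      · simp only [Store.mk.injEq, and_true]
        rw [min_eq_left hk.le, min_eq_left hk]
        funext m
        by_cases h1 : m = 18
        · simp [h1]
        by_cases h2 : m = r
        · simp [h2, hr, Nat.succ_mul]
        · simp [h1, h2]
      · simp only [Store.mk.injEq, and_true]
        rw [min_eq_right (by omega), min_eq_right (by omega)]
        funext m
        by_cases h1 : m = 18 <;> simp [h1]
  change iter (eval G (ite 18 x (prim (.add r r 2)) skip)) 18 (Function.update s.reg r 0 2)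
    { s with reg := Function.update s.reg r 0 } = _
  rw [Function.update_of_ne hr2.symm, key, min_eq_right h]

theorem eval_gAddr (G : OCFGame n) {r k a : ℕ} (s : Store) (h : s.reg k ≤ s.reg 2) (hr : r ≠ 18)
    (hrk : r ≠ k) (hr2 : r ≠ 2) (hk : k ≠ 18) (hra : r ≠ a) (ha : a ≠ 18) :
    eval G (gAddr r k a) s = { s with
      reg := Function.update (Function.update s.reg r (s.reg 2 + s.reg k * s.reg 2 + s.reg a))
        18 (s.reg 2) } := by
  simp only [gAddr, prims, List.foldr, eval, eval_mul G s h hr hrk hr2 hk, Instr.act,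
    Store.mk.injEq, and_true]
  funext m
  by_cases h1 : m = 18
  · simp [h1, hr.symm]
  by_cases h2 : m = r
  · simp [h2, hr, hra.symm, ha, hr2.symm, Nat.add_comm]
  · simp [h1, h2]

theorem eval_hAddr (G : OCFGame n) {r x y : ℕ} (s : Store) (h : s.reg x ≤ s.reg 2) (hr : r ≠ 18)
    (hrx : r ≠ x) (hr2 : r ≠ 2) (hx : x ≠ 18) (hry : r ≠ y) (hy : y ≠ 18) (hr6 : r ≠ 6) :
    eval G (hAddr r x y) s = { s with
      reg := Function.update (Function.update s.reg r (s.reg 6 + s.reg x * s.reg 2 + s.reg y))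
        18 (s.reg 2) } := by
  simp only [hAddr, prims, List.foldr, eval, eval_mul G s h hr hrx hr2 hx, Instr.act,
    Store.mk.injEq, and_true]
  funext m
  by_cases h1 : m = 18
  · simp [h1, hr.symm]
  by_cases h2 : m = r
  · simp [h2, hr, hry.symm, hy, hr6.symm, Nat.add_comm]
  · simp [h1, h2]

/-- The query vector is written into zeroed cells and erased afterwards, so the memory is unchanged.
Only `n` cells are read, so the extra index `n` is harmless as an argument. -/
theorem eval_queryPair (G : OCFGame n) {i p j q : ℕ} (s : Store) (hp : p < 19)
    (hj : j < 19) (hq : q < 19) (h5 : s.reg 5 = 0) (hm : ∀ k, s.mem (s.reg 8 + k) = 0) :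
    eval G (queryPair i p j q) s = { s with
      reg := Function.update (Function.update s.reg 19 (s.reg 8 + s.reg i)) 20
        (s.reg 8 + s.reg j)
      val := Function.update s.val (s.reg 4)
        (G.natOracle (MergeDP.pairVec (s.reg i) (s.reg p) (s.reg j) (s.reg q))) } := by
  have n2 : p ≠ 19 := hp.ne
  have n3 : j ≠ 19 := hj.ne
  have n4 : q ≠ 19 := hq.ne
  have n5 : q ≠ 20 := by omega
  simp only [queryPair, prims, List.foldr, eval, Instr.act, ne_eq, n2, n3, n4, n5,
    not_false_eq_true, Function.update_of_ne, Function.update_self,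
    Nat.reduceEqDiff, h5, Store.mk.injEq, true_and]
  constructor
  · funext a
    simp only [Function.update_apply]
    split_ifs with h1 h2
    · rw [h1, hm]
    · rw [h2, hm]
    · rfl
  · refine congrArg _ ?_
    unfold OCFGame.natOracle
    refine congrArg _ (funext fun k => ?_)
    simp only [MergeDP.pairVec, Function.update_apply, Nat.add_left_cancel_iff, hm, Pi.zero_apply]

/-- `reg 17 := 1` if the pair `(reg 10, reg 11)` passes the isolation test, and `0` otherwise. -/
def test : Cmd :=
  seq (prim (.const 17 1)) (loop 12 0
    (prims [.add 19 7 12, .load 19 19, .sub 20 12 10, .sub 21 10 12, .add 20 20 21,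
      .sub 21 12 11, .sub 22 11 12, .add 21 21 22]
    (ite 19 1 (ite 5 20 (ite 5 21 (loop 13 2 (loop 14 2
      (ite 5 13 (ite 5 14
        (seq (queryPair 10 13 12 14) (vite 4 1 skip (prim (.const 17 0)))) skip) skip)))
      skip) skip) skip)))

/-- Fill the table `h` for the pair `(reg 10, reg 11)`. -/
def fillTable : Cmd :=
  loop 15 2 (loop 16 2
    (seq (gAddr 19 10 15) (seq (gAddr 20 11 16) (seq (hAddr 21 15 16) (seq (prim (.vadd 21 19 20))
    (loop 13 2 (loop 14 2 (ite 15 13 skip (ite 16 14 skip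
      (seq (queryPair 10 13 11 14) (prims [.sub 22 15 13, .sub 23 16 14]
      (seq (hAddr 24 22 23) (seq (prim (.vadd 4 24 4))
      (vite 4 21 skip (prim (.vcopy 21 4))))))))))))))))

/-- Copy the row of `h` that belongs to the whole weight of `reg 10` to the table of `reg 11`. -/
def copyRow : Cmd :=
  loop 16 2 (prims [.add 19 0 10, .load 22 19]
    (seq (hAddr 21 22 16) (seq (gAddr 20 11 16) (prim (.vcopy 20 21)))))

/-- Merge `reg 10` into `reg 11`. -/
def merge : Cmd :=
  seq fillTable (seq copyRow (prims [.add 19 7 10] (prim (.store 19 1))))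

/-- Merge `reg 10` into `reg 11` if both are left and the pair passes the isolation test. -/
def visit : Cmd :=
  prims [.add 19 7 10, .load 19 19, .add 20 7 11, .load 20 20, .sub 21 10 11, .sub 22 11 10,
    .add 21 21 22]
  (ite 19 1 (ite 20 1 (ite 5 21 (seq test (ite 5 17 merge skip)) skip) skip) skip)

/-- Eliminate all agents. -/
def eliminate : Cmd := loop 9 0 (loop 10 0 (loop 11 3 visit))

/-- Compute `K = n + 3 + ∑ i, W i` in register `2`. -/
def computeBound : Cmd :=
  prims [.const 4 2, .add 3 0 1, .add 2 3 4]
    (loop 12 0 (prims [.load 19 12] (prim (.add 2 2 19))))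

/-- Compute the base addresses. -/
def computeBases : Cmd := seq (mul 6 2) (prims [.add 6 6 2, .add 7 2 2] (prim (.add 8 7 2)))

/-- Compare the optimum with the threshold. -/
def answer : Cmd :=
  seq (gAddr 19 0 5) (seq (vite 5 19 (prim (.const 17 1)) (prim (.const 17 0)))
    (prim (.vcopy 5 19)))

/-- The whole program. -/
def optVal : Cmd :=
  seq (prim (.const 1 1)) (seq computeBound (seq computeBases (seq (seq eliminate answer)
    (prim (.add 0 17 5)))))

/-- Registers `2` and `3` are still being written in this phase, so only `n` and the constant `1`
are protected. -/
theorem wf_computeBound : computeBound.WF [0, 1] := by decide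

theorem wf_computeBases : computeBases.WF [0, 1, 2, 3] := by decide

theorem wf_eliminate : (seq eliminate answer).WF [0, 1, 2, 3] := by decide

end Cmd

/-! ### Correctness of the isolation test -/

namespace Cmd

variable {n : ℕ}

open MergeDP

/-- The registers that stay constant during the elimination. -/
structure Consts (n K : ℕ) (s : Store) : Prop where
  reg0 : s.reg 0 = n
  reg1 : s.reg 1 = 1
  reg2 : s.reg 2 = K
  reg3 : s.reg 3 = n + 1
  reg4 : s.reg 4 = 2
  reg5 : s.reg 5 = 0
  reg6 : s.reg 6 = K + K * K
  reg7 : s.reg 7 = K + K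
  reg8 : s.reg 8 = K + K + K

theorem Consts.congr {K : ℕ} {s s' : Store} (hs : Consts n K s)
    (h : ∀ m ≤ 8, s'.reg m = s.reg m) : Consts n K s' where
  reg0 := by rw [h 0 (by decide), hs.reg0]
  reg1 := by rw [h 1 (by decide), hs.reg1]
  reg2 := by rw [h 2 (by decide), hs.reg2]
  reg3 := by rw [h 3 (by decide), hs.reg3]
  reg4 := by rw [h 4 (by decide), hs.reg4]
  reg5 := by rw [h 5 (by decide), hs.reg5]
  reg6 := by rw [h 6 (by decide), hs.reg6]
  reg7 := by rw [h 7 (by decide), hs.reg7]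
  reg8 := by rw [h 8 (by decide), hs.reg8]

theorem Consts.eval {G : OCFGame n} {K : ℕ} {s : Store} (hs : Consts n K s) {c : Cmd}
    (hc : ∀ m ≤ 8, m ∉ c.targets) : Consts n K (eval G c s) :=
  hs.congr fun m hm => eval_reg G c s (hc m hm)

/-- The memories agree, except for the scratch cell for values. -/
def Same (s s' : Store) : Prop := s'.mem = s.mem ∧ ∀ a, a ≠ 2 → s'.val a = s.val a

theorem Same.refl (s : Store) : Same s s := ⟨rfl, fun _ _ => rfl⟩

theorem Same.trans {s s' s'' : Store} (h : Same s s') (h' : Same s' s'') : Same s s'' :=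
  ⟨h'.1.trans h.1, fun a ha => (h'.2 a ha).trans (h.2 a ha)⟩

/-- A loop whose body clears the flag in register `17` unless a condition holds. -/
theorem loop_flag {G : OCFGame n} {r l : ℕ} {c : Cmd} {s : Store} (ok : ℕ → Prop) (hr : r ≠ 17)
    (h : ∀ k < s.reg l, ∀ s', (∀ m, m ≠ r → m ∉ c.targets → s'.reg m = s.reg m) →
      s'.reg r = k → Same s s' →
        Same s' (eval G c s') ∧ (0 < (eval G c s').reg 17 ↔ 0 < s'.reg 17 ∧ ok k)) :
    Same s (eval G (loop r l c) s) ∧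
      (0 < (eval G (loop r l c) s).reg 17 ↔ 0 < s.reg 17 ∧ ∀ k < s.reg l, ok k) := by
  refine loop_induction (G := G) (c := c) (r := r) (l := l)
    (fun N s' => Same s s' ∧ (0 < s'.reg 17 ↔ 0 < s.reg 17 ∧ ∀ k < N, ok k)) ?_ ?_
  · exact ⟨Same.refl s, by simp [setReg, Function.update_of_ne hr.symm]⟩
  · rintro k hk s' hf hrk ⟨h1, h2⟩
    obtain ⟨h3, h4⟩ := h k hk s' hf hrk h1
    refine ⟨h1.trans h3, ?_⟩
    simp only [setReg, Function.update_of_ne hr.symm]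
    rw [h4, h2, and_assoc, Nat.forall_lt_succ_right]

/-- The flag starts at `1` and is only ever cleared; three nested uses of `loop_flag` turn it into
the three quantifiers. Value cell `1` supplies the constant `0` for the comparison. -/
theorem eval_test {G : OCFGame n} {K : ℕ} {s : Store} (hs : Consts n K s)
    (hm : ∀ k, s.mem (K + K + K + k) = 0) (hv : s.val 1 = 0) :
    Same s (eval G test s) ∧ (0 < (eval G test s).reg 17 ↔ ∀ k < n, s.mem (K + K + k) < 1 →
      k ≠ s.reg 10 → k ≠ s.reg 11 → ∀ p < K, ∀ q < K, 0 < p → 0 < q →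
        G.natOracle (pairVec (s.reg 10) p k q) ≤ 0) := by
  rw [test, eval]
  set s0 := eval G (prim (.const 17 1)) s with hs0
  have e0 : Same s s0 := ⟨rfl, fun _ _ => rfl⟩
  have c0 : Consts n K s0 := hs.eval (by decide)
  have r10 : s0.reg 10 = s.reg 10 := rfl
  have r11 : s0.reg 11 = s.reg 11 := rfl
  have r17 : s0.reg 17 = 1 := rfl
  clear_value s0
  have key := loop_flag (G := G) (r := 12) (l := 0) (s := s0) (c := prims [.add 19 7 12,
      .load 19 19, .sub 20 12 10, .sub 21 10 12, .add 20 20 21, .sub 21 12 11, .sub 22 11 12,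
      .add 21 21 22] (ite 19 1 (ite 5 20 (ite 5 21 (loop 13 2 (loop 14 2 (ite 5 13 (ite 5 14
        (seq (queryPair 10 13 12 14) (vite 4 1 skip (prim (.const 17 0)))) skip) skip)))
      skip) skip) skip)) (fun k => s.mem (K + K + k) < 1 → k ≠ s.reg 10 → k ≠ s.reg 11 →
        ∀ p < K, ∀ q < K, 0 < p → 0 < q → G.natOracle (pairVec (s.reg 10) p k q) ≤ 0)
      (by decide) ?_
  · refine ⟨e0.trans key.1, ?_⟩
    rw [key.2, r17, c0.reg0]
    simp
  intro k _ s1 hf1 h12 hsame1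
  have c1 : Consts n K s1 := c0.congr fun m hm =>
    hf1 m (by omega) (by revert m; decide)
  have s10 : s1.reg 10 = s.reg 10 := (hf1 10 (by decide) (by decide)).trans r10
  have s11 : s1.reg 11 = s.reg 11 := (hf1 11 (by decide) (by decide)).trans r11
  have e1 := e0.trans hsame1
  rw [eval_prims]
  set s2 := List.foldl (fun s i => Instr.act G s i) s1 _ with hs2
  have c2 : Consts n K s2 := c1.congr (by intro m hm; interval_cases m <;> rfl)
  have t12 : s2.reg 12 = k := h12
  have t10 : s2.reg 10 = s.reg 10 := s10
  have t11 : s2.reg 11 = s.reg 11 := s11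
  have t17 : s2.reg 17 = s1.reg 17 := rfl
  have t19 : s2.reg 19 = s.mem (K + K + k) := by
    simp [hs2, Instr.act, c1.reg7, h12, e1.1]
  -- The two truncated differences add up to the distance, which is positive exactly when the agents
  -- differ.
  have t20 : s2.reg 20 = k - s.reg 10 + (s.reg 10 - k) := by
    simp [hs2, Instr.act, h12, s10]
  have t21 : s2.reg 21 = k - s.reg 11 + (s.reg 11 - k) := by
    simp [hs2, Instr.act, h12, s11]
  have e2 : Same s s2 := e1
  change Same s2 _ ∧ _
  rw [← t17]
  clear_value s2
  clear hf1 hsame1 e1 c1 s10 s11 h12 hs2 t17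
  simp only [eval.eq_4, t19, c2.reg1, t20, t21, c2.reg5]
  by_cases a1 : s.mem (K + K + k) < 1
  swap
  · rw [if_neg a1]
    exact ⟨Same.refl _, by simp [eval, a1]⟩
  rw [if_pos a1]
  by_cases a2 : k = s.reg 10
  · rw [if_neg (by omega)]
    exact ⟨Same.refl _, by simp [eval, a2]⟩
  rw [if_pos (by omega)]
  by_cases a3 : k = s.reg 11
  · rw [if_neg (by omega)]
    exact ⟨Same.refl _, by simp [eval, a3]⟩
  rw [if_pos (by omega)]
  simp only [a1, a2, a3, ne_eq, not_false_eq_true, forall_const]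
  rw [← c2.reg2]
  refine loop_flag (fun p => ∀ q < s2.reg 2, 0 < p → 0 < q →
    G.natOracle (pairVec (s.reg 10) p k q) ≤ 0) (by decide) ?_
  intro p _ s3 hf3 h13 hsame3
  have c3 : Consts n K s3 := c2.congr fun m hm => hf3 m (by omega) (by revert m; decide)
  rw [c2.reg2, ← c3.reg2]
  refine loop_flag (fun q => 0 < p → 0 < q → G.natOracle (pairVec (s.reg 10) p k q) ≤ 0)
    (by decide) ?_
  intro q _ s4 hf4 h14 hsame4
  have c4 : Consts n K s4 := c3.congr fun m hm => hf4 m (by omega) (by revert m; decide)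
  have u13 : s4.reg 13 = p := by rw [hf4 13 (by decide) (by decide), h13]
  have u12 : s4.reg 12 = k := by
    rw [hf4 12 (by decide) (by decide), hf3 12 (by decide) (by decide), t12]
  have u10 : s4.reg 10 = s.reg 10 := by
    rw [hf4 10 (by decide) (by decide), hf3 10 (by decide) (by decide), t10]
  have e4 : Same s s4 := (e2.trans hsame3).trans hsame4
  have hm4 : ∀ k, s4.mem (s4.reg 8 + k) = 0 := fun k => by rw [c4.reg8, e4.1, hm]
  simp only [eval.eq_4, c4.reg5, u13, h14]
  by_cases p0 : 0 < p
  swap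
  · rw [if_neg p0]
    exact ⟨Same.refl _, by simp [eval, p0]⟩
  rw [if_pos p0]
  by_cases q0 : 0 < q
  swap
  · rw [if_neg q0]
    exact ⟨Same.refl _, by simp [eval, q0]⟩
  rw [if_pos q0]
  simp only [p0, q0, forall_const]
  rw [eval.eq_3, eval_queryPair G s4 (by decide) (by decide) (by decide) c4.reg5 hm4]
  simp only [eval, u10, u12, u13, h14, c4.reg4, c4.reg1, ne_eq, not_false_eq_true,
    Function.update_of_ne, Function.update_self, Nat.reduceEqDiff, OfNat.one_ne_ofNat,
    e4.2 1 (by decide), hv]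
  split_ifs with hle
  · refine ⟨⟨rfl, fun a ha => ?_⟩, ?_⟩
    · exact Function.update_of_ne ha _ _
    · simp [hle]
  · refine ⟨⟨rfl, fun a ha => ?_⟩, ?_⟩
    · exact Function.update_of_ne ha _ _
    · simp [hle, Instr.act]

end Cmd

/-! ### Filling the knapsack table -/

namespace Cmd

variable {n : ℕ}

open MergeDP

/-- The table entry `g k a`. -/
def gTab (K : ℕ) (s : Store) (k a : ℕ) : ℝ := s.val (K + k * K + a)

/-- The table entry `h x y`. -/
def hTab (K : ℕ) (s : Store) (x y : ℕ) : ℝ := s.val (K + K * K + x * K + y)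

/-- Tables are stored in rows of length `K`, so distinct entries occupy distinct cells. -/
theorem mul_add_inj {K x y x' y' : ℕ} (hy : y < K) (hy' : y' < K) (h : x * K + y = x' * K + y') :
    x = x' ∧ y = y' := by
  rcases lt_trichotomy x x' with hx | hx | hx
  · have := Nat.mul_le_mul_right K hx
    rw [Nat.succ_mul] at this
    omega
  · subst hx; exact ⟨rfl, by omega⟩
  · have := Nat.mul_le_mul_right K hx
    rw [Nat.succ_mul] at this
    omega

theorem mul_add_lt {K k a : ℕ} (hk : k < K) (ha : a < K) : k * K + a < K * K := by
  have := Nat.mul_le_mul_right K hk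
  rw [Nat.succ_mul] at this
  omega

/-- The body of the innermost loop of `fillTable`. -/
def relax : Cmd :=
  ite 15 13 skip (ite 16 14 skip
    (seq (queryPair 10 13 11 14) (prims [.sub 22 15 13, .sub 23 16 14]
    (seq (hAddr 24 22 23) (seq (prim (.vadd 4 24 4))
    (vite 4 21 skip (prim (.vcopy 21 4))))))))

/-- One knapsack relaxation. Since `3 ≤ K`, the tables avoid value cell `2`, which receives the
oracle answers. -/
theorem eval_relax {G : OCFGame n} {K i j p q x y : ℕ} {s : Store} (hs : Consts n K s)
    (hK : 3 ≤ K) (hm : ∀ k, s.mem (K + K + K + k) = 0) (h10 : s.reg 10 = i) (h11 : s.reg 11 = j)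
    (h13 : s.reg 13 = p) (h14 : s.reg 14 = q) (h15 : s.reg 15 = x) (h16 : s.reg 16 = y)
    (hx : x < K) (h21 : s.reg 21 = K + K * K + x * K + y) :
    (eval G relax s).mem = s.mem ∧
    (∀ a, a ≠ 2 → a ≠ K + K * K + x * K + y → (eval G relax s).val a = s.val a) ∧
    hTab K (eval G relax s) x y = if p ≤ x ∧ q ≤ y then
      max (hTab K s x y) (hTab K s (x - p) (y - q) + G.natOracle (pairVec i p j q))
      else hTab K s x y := by
  rw [relax, eval.eq_4, h15, h13]
  by_cases hp : x < p
  · rw [if_pos hp]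
    exact ⟨rfl, fun _ _ _ => rfl, by rw [if_neg (by omega)]; rfl⟩
  rw [if_neg hp, eval.eq_4, h16, h14]
  by_cases hq : y < q
  · rw [if_pos hq]
    exact ⟨rfl, fun _ _ _ => rfl, by rw [if_neg (by omega)]; rfl⟩
  rw [if_neg hq, if_pos (by omega), eval.eq_3,
    eval_queryPair G s (by decide) (by decide) (by decide) hs.reg5 (by rw [hs.reg8]; exact hm),
    eval_prims, eval.eq_3, eval_hAddr]
  · simp only [List.foldl, eval, Instr.act, h10, h11, h13, h14, h15, h16, h21, hs.reg4, hs.reg6,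
      hs.reg2, ne_eq, not_false_eq_true, Function.update_of_ne, Function.update_self,
      Nat.reduceEqDiff, hTab]
    have n1 : K + K * K + (x - p) * K + (y - q) ≠ 2 := by omega
    have n2 : K + K * K + x * K + y ≠ 2 := by omega
    simp only [n1, n2, ne_eq, not_false_eq_true, Function.update_of_ne]
    split_ifs with hle
    · refine ⟨rfl, fun a ha _ => by simp [ha], ?_⟩
      simp only [n2, ne_eq, not_false_eq_true, Function.update_of_ne]
      exact (max_eq_left hle).symm
    · refine ⟨rfl, fun a ha ha' => by simp [ha, ha'], ?_⟩
      simp only [Function.update_self]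
      exact (max_eq_right (not_le.1 hle).le).symm
  · simp [Instr.act, h15, h13, hs.reg2]; omega
  all_goals decide

/-- The entry `h x y` is correct. -/
def EntryOK (gi gj : ℕ → ℝ) (u : ℕ → ℕ → ℝ) (h : ℕ → ℕ → ℝ) (x y : ℕ) : Prop :=
  gi x + gj y ≤ h x y ∧ (∀ p ≤ x, ∀ q ≤ y, h (x - p) (y - q) + u p q ≤ h x y) ∧
    Reach gi gj u x y (h x y)

/-- The two innermost loops of `fillTable` compute one entry. -/
theorem eval_relaxLoop {G : OCFGame n} {K i j x y : ℕ} {gi gj : ℕ → ℝ} {s : Store}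
    (hs : Consts n K s) (hK : 3 ≤ K) (hm : ∀ k, s.mem (K + K + K + k) = 0) (h10 : s.reg 10 = i)
    (h11 : s.reg 11 = j) (h15 : s.reg 15 = x) (h16 : s.reg 16 = y) (hx : x < K) (hy : y < K)
    (h21 : s.reg 21 = K + K * K + x * K + y) (hbase : hTab K s x y = gi x + gj y)
    (hprev : ∀ x' ≤ x, ∀ y' ≤ y, (x' ≠ x ∨ y' ≠ y) →
      Reach gi gj (fun p q => G.natOracle (pairVec i p j q)) x' y' (hTab K s x' y')) :
    (eval G (loop 13 2 (loop 14 2 relax)) s).mem = s.mem ∧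
    (∀ a, a ≠ 2 → a ≠ K + K * K + x * K + y →
      (eval G (loop 13 2 (loop 14 2 relax)) s).val a = s.val a) ∧
    EntryOK gi gj (fun p q => G.natOracle (pairVec i p j q))
      (hTab K (eval G (loop 13 2 (loop 14 2 relax)) s)) x y := by
  set u : ℕ → ℕ → ℝ := fun p q => G.natOracle (pairVec i p j q) with hu
  have hu0 : u 0 0 = 0 := by
    have : pairVec i 0 j 0 = 0 := by
      funext k; simp only [pairVec, Function.update_apply]; split_ifs <;> rfl
    simp only [hu, this, G.natOracle_zero]
  -- The bundle `(0, 0)` is set apart: its candidate reads the entry being updated, and it is worth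
  -- `0`. All other candidates read entries that this loop does not change.
  let ok : ℕ → ℕ → ℝ → Prop := fun p q w => p ≤ x → q ≤ y → (p ≠ 0 ∨ q ≠ 0) →
    hTab K s (x - p) (y - q) + u p q ≤ w
  have okmono : ∀ p q w w', ok p q w → w ≤ w' → ok p q w' := fun p q w w' h hw a b c =>
    (h a b c).trans hw
  let I : (ℝ → Prop) → Store → Prop := fun Q s' => s'.mem = s.mem ∧
    (∀ a, a ≠ 2 → a ≠ K + K * K + x * K + y → s'.val a = s.val a) ∧
    gi x + gj y ≤ hTab K s' x y ∧ Reach gi gj u x y (hTab K s' x y) ∧ Q (hTab K s' x y)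
  have hoff : ∀ s' : Store, (∀ a, a ≠ 2 → a ≠ K + K * K + x * K + y → s'.val a = s.val a) →
      ∀ x' < K, ∀ y' < K, (x' ≠ x ∨ y' ≠ y) →
      hTab K s' x' y' = hTab K s x' y' := by
    intro s' h x' _ y' hy' hne
    refine h _ (by omega) fun he => ?_
    have := mul_add_inj (x := x') (x' := x) hy' hy (by omega)
    omega
  have key : I (fun w => ∀ p < K, ∀ q < K, ok p q w) (eval G (loop 13 2 (loop 14 2 relax)) s) := by
    have := loop_induction (G := G) (c := loop 14 2 relax) (r := 13) (l := 2) (s := s)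
      (fun N s' => I (fun w => ∀ p < N, ∀ q < K, ok p q w) s') ?_ ?_
    · rwa [hs.reg2] at this
    · refine ⟨rfl, fun _ _ _ => rfl, hbase.ge, ?_, fun p hp => absurd hp (Nat.not_lt_zero p)⟩
      change Reach gi gj u x y (hTab K s x y)
      rw [hbase]
      exact Reach.base x y
    intro p _ s1 hf1 h13 hI1
    have c1 : Consts n K s1 := hs.congr fun m hm => hf1 m (by omega) (by revert m; decide)
    have := loop_induction (G := G) (c := relax) (r := 14) (l := 2) (s := s1)
      (fun N s' => I (fun w => (∀ p' < p, ∀ q < K, ok p' q w) ∧ ∀ q < N, ok p q w) s') ?_ ?_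
    · rw [c1.reg2] at this
      obtain ⟨a1, a2, a3, a4, a5, a6⟩ := this
      refine ⟨a1, a2, a3, a4, fun p' hp' => ?_⟩
      rcases Nat.lt_succ_iff_lt_or_eq.1 hp' with hp' | rfl
      · exact a5 p' hp'
      · exact a6
    · obtain ⟨a1, a2, a3, a4, a5⟩ := hI1
      exact ⟨a1, a2, a3, a4, a5, fun q hq => absurd hq (Nat.not_lt_zero q)⟩
    intro q _ s2 hf2 h14 hI2
    have hoff2 := hoff _ hI2.2.1
    obtain ⟨a1, a2, a3, a4, a5, a6⟩ := hI2
    have c2 : Consts n K s2 := c1.congr fun m hm => hf2 m (by omega) (by revert m; decide)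
    have fr : ∀ m, m ≠ 13 → m ∉ (loop 14 2 relax).targets → s2.reg m = s.reg m := by
      intro m hm hm'
      have h2 : m ≠ 14 ∧ m ∉ relax.targets := by simpa [targets] using hm'
      rw [hf2 m h2.1 h2.2, hf1 m hm hm']
    obtain ⟨b1, b2, b3⟩ := eval_relax (G := G) (K := K) (i := i) (j := j) (p := p) (q := q) (x := x)
      (y := y) (s := s2) c2 hK (fun k => by rw [a1, hm])
      (by rw [fr 10 (by decide) (by decide), h10]) (by rw [fr 11 (by decide) (by decide), h11])
      (by rw [hf2 13 (by decide) (by decide), h13]) h14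
      (by rw [fr 15 (by decide) (by decide), h15]) (by rw [fr 16 (by decide) (by decide), h16]) hx
      (by rw [fr 21 (by decide) (by decide), h21])
    have hle : hTab K s2 x y ≤ hTab K (eval G relax s2) x y := by
      rw [b3]; split_ifs
      · exact le_max_left _ _
      · exact le_rfl
    refine ⟨b1.trans a1, fun a h1 h2 => (b2 a h1 h2).trans (a2 a h1 h2), a3.trans hle, ?_,
      fun p' hp' q' hq' => okmono _ _ _ _ (a5 p' hp' q' hq') hle, fun q' hq' => ?_⟩
    · change Reach gi gj u x y (hTab K (eval G relax s2) x y)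
      rw [b3]
      split_ifs with hpq
      · rcases max_choice (hTab K s2 x y)
          (hTab K s2 (x - p) (y - q) + G.natOracle (pairVec i p j q)) with he | he
        · rw [he]; exact a4
        · rw [he]
          by_cases h0 : p = 0 ∧ q = 0
          · obtain ⟨rfl, rfl⟩ := h0
            have : G.natOracle (pairVec i 0 j 0) = 0 := hu0
            rw [this, add_zero]
            exact a4
          · rw [hoff2 _ (by omega) _ (by omega) (by omega)]
            have := Reach.step _ _ p q _ (hprev (x - p) (by omega) (y - q) (by omega) (by omega))
            rw [Nat.sub_add_cancel hpq.1, Nat.sub_add_cancel hpq.2] at this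
            exact this
      · exact a4
    · rcases Nat.lt_succ_iff_lt_or_eq.1 hq' with hq' | rfl
      · exact okmono _ _ _ _ (a6 q' hq') hle
      · intro hp hq h0
        change _ ≤ hTab K (eval G relax s2) x y
        rw [b3, if_pos ⟨hp, hq⟩, hoff2 (x - p) (by omega) (y - q') (by omega) (by omega)]
        exact le_max_right _ _
  have hoffE := hoff _ key.2.1
  obtain ⟨a1, a2, a3, a4, a5⟩ := key
  refine ⟨a1, a2, a3, fun p hp q hq => ?_, a4⟩
  by_cases h0 : p = 0 ∧ q = 0
  · obtain ⟨rfl, rfl⟩ := h0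
    rw [hu0, add_zero]
    exact le_rfl
  · rw [hoffE _ (by omega) _ (by omega) (by omega)]
    exact a5 p (by omega) q (by omega) hp hq (by omega)

/-- The table `h` is filled as required by `IsMerge`. -/
theorem eval_fillTable {G : OCFGame n} {K i j : ℕ} {s : Store} (hs : Consts n K s) (hK : 3 ≤ K)
    (hm : ∀ k, s.mem (K + K + K + k) = 0) (h10 : s.reg 10 = i) (h11 : s.reg 11 = j) (hi : i < K)
    (hj : j < K) :
    (eval G fillTable s).mem = s.mem ∧
    (∀ a < K + K * K, a ≠ 2 → (eval G fillTable s).val a = s.val a) ∧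
    IsMerge (gTab K s i) (gTab K s j) (fun p q => G.natOracle (pairVec i p j q)) K
      (hTab K (eval G fillTable s)) := by
  set u : ℕ → ℕ → ℝ := fun p q => G.natOracle (pairVec i p j q) with hu
  let body : Cmd := seq (gAddr 19 10 15) (seq (gAddr 20 11 16) (seq (hAddr 21 15 16)
    (seq (prim (.vadd 21 19 20)) (loop 13 2 (loop 14 2 relax)))))
  -- Entries are completed in lexicographic order, which makes every entry with smaller budgets
  -- available in time.
  let I : ℕ → ℕ → Store → Prop := fun X Y s' => s'.mem = s.mem ∧
    (∀ a < K + K * K, a ≠ 2 → s'.val a = s.val a) ∧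
    ∀ x < K, ∀ y < K, (x < X ∨ x = X ∧ y < Y) → EntryOK (gTab K s i) (gTab K s j) u (hTab K s') x y
  have key : I K 0 (eval G (loop 15 2 (loop 16 2 body)) s) := by
    have := loop_induction (G := G) (c := loop 16 2 body) (r := 15) (l := 2) (s := s)
      (fun N s' => I N 0 s') ?_ ?_
    · rwa [hs.reg2] at this
    · exact ⟨rfl, fun _ _ _ => rfl, fun x _ y _ h => by omega⟩
    intro x hx s1 hf1 h15 hI1
    rw [hs.reg2] at hx
    have c1 : Consts n K s1 := hs.congr fun m hm => hf1 m (by omega) (by revert m; decide)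
    have := loop_induction (G := G) (c := body) (r := 16) (l := 2) (s := s1)
      (fun N s' => I x N s') ?_ ?_
    · rw [c1.reg2] at this
      obtain ⟨a1, a2, a3⟩ := this
      exact ⟨a1, a2, fun x' hx' y' hy' h => a3 x' hx' y' hy' (by omega)⟩
    · exact hI1
    intro y hy s2 hf2 h16 hI2
    rw [c1.reg2] at hy
    obtain ⟨a1, a2, a3⟩ := hI2
    have c2 : Consts n K s2 := c1.congr fun m hm => hf2 m (by omega) (by revert m; decide)
    have g15 : s2.reg 15 = x := by rw [hf2 15 (by decide) (by decide), h15]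
    have g10 : s2.reg 10 = i := by
      rw [hf2 10 (by decide) (by decide), hf1 10 (by decide) (by decide), h10]
    have g11 : s2.reg 11 = j := by
      rw [hf2 11 (by decide) (by decide), hf1 11 (by decide) (by decide), h11]
    have hgi := mul_add_lt hi hx
    have hgj := mul_add_lt hj hy
    -- In `s3` the entry holds its base value, where nothing is bought.
    obtain ⟨s3, hs3, c3, f3, m3, v3⟩ : ∃ s3, eval G body s2
          = eval G (loop 13 2 (loop 14 2 relax)) s3 ∧ Consts n K s3 ∧
        (s3.reg 10 = i ∧ s3.reg 11 = j ∧ s3.reg 15 = x ∧ s3.reg 16 = y ∧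
          s3.reg 21 = K + K * K + x * K + y) ∧ s3.mem = s2.mem ∧
        s3.val = Function.update s2.val (K + K * K + x * K + y) (gTab K s i x + gTab K s j y) := by
      refine ⟨_, rfl, c2.congr ?_, ?_⟩
      · intro m hm
        rw [eval_reg, eval_reg, eval_reg, eval_reg] <;> (revert m; decide)
      · rw [eval_gAddr G s2 (by rw [g10, c2.reg2]; omega) (by decide) (by decide) (by decide)
          (by decide) (by decide) (by decide), eval_gAddr (r := 20), eval_hAddr]
        · simp only [eval, Instr.act, g10, g11, g15, h16, c2.reg2, c2.reg6, ne_eq,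
            not_false_eq_true, Function.update_of_ne, Function.update_self, Nat.reduceEqDiff,
            true_and]
          refine congrArg _ ?_
          simp only [gTab]
          rw [a2 _ (by omega) (by omega), a2 _ (by omega) (by omega)]
        · simp [g15, c2.reg2]; omega
        iterate 7 decide
        · simp [g11, c2.reg2]; omega
        all_goals decide
    rw [hs3]
    have hlt : ∀ x' ≤ x, ∀ y' ≤ y, (x' ≠ x ∨ y' ≠ y) → hTab K s3 x' y' = hTab K s2 x' y' := by
      intro x' hx' y' hy' hne
      simp only [hTab, v3]
      refine Function.update_of_ne (fun he => ?_) _ _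
      have := mul_add_inj (x := x') (x' := x) (by omega : y' < K) hy (by omega)
      omega
    obtain ⟨b1, b2, b3⟩ := eval_relaxLoop (G := G) (gi := gTab K s i) (gj := gTab K s j) c3 hK
      (fun k => by rw [m3, a1, hm]) f3.1 f3.2.1 f3.2.2.1 f3.2.2.2.1 hx hy f3.2.2.2.2
      (by simp [hTab, v3]) (fun x' hx' y' hy' hne => by
        rw [hlt x' hx' y' hy' hne]
        exact (a3 x' (by omega) y' (by omega) (by omega)).2.2)
    set s4 := eval G (loop 13 2 (loop 14 2 relax)) s3 with hs4
    clear_value s4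
    refine ⟨b1.trans (m3.trans a1), fun a ha ha2 => ?_, fun x' hx' y' hy' h => ?_⟩
    · change s4.val a = _
      rw [b2 a ha2 (by omega), v3, Function.update_of_ne (by omega), a2 a ha ha2]
    · change EntryOK _ _ u (hTab K s4) x' y'
      have hoff : ∀ x₁ < K, ∀ y₁ < K, (x₁ < x ∨ x₁ = x ∧ y₁ < y) →
          hTab K s4 x₁ y₁ = hTab K s2 x₁ y₁ := by
        intro x₁ hx₁ y₁ hy₁ h'
        have hne : K + K * K + x₁ * K + y₁ ≠ K + K * K + x * K + y := by
          intro he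
          have := mul_add_inj (x := x₁) (x' := x) hy₁ hy (by omega)
          omega
        simp only [hTab]
        rw [b2 _ (by omega) hne, v3, Function.update_of_ne hne]
      by_cases hxy : x' = x ∧ y' = y
      · rw [hxy.1, hxy.2]; exact b3
      · obtain ⟨e1, e2, e3⟩ := a3 x' hx' y' hy' (by omega)
        unfold EntryOK
        rw [hoff x' hx' y' hy' (by omega)]
        refine ⟨e1, fun p hp q hq => ?_, e3⟩
        rw [hoff _ (by omega) _ (by omega) (by omega)]
        exact e2 p hp q hq
  obtain ⟨a1, a2, a3⟩ := key
  exact ⟨a1, a2, fun x hx y hy => (a3 x hx y hy (Or.inl hx)).1,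
    fun x hx y hy => (a3 x hx y hy (Or.inl hx)).2.1,
    fun x hx y hy => (a3 x hx y hy (Or.inl hx)).2.2⟩

end Cmd

/-! ### Merging and the elimination loop -/

namespace Cmd

variable {n : ℕ}

open MergeDP

/-- The row `x` is the full weight of `i`, all of which is at the table's disposal once `i` is gone.
The destination lies below the table `h`, so no source entry is overwritten. -/
theorem eval_copyRow {G : OCFGame n} {K i j x : ℕ} {s : Store} (hs : Consts n K s)
    (h10 : s.reg 10 = i) (h11 : s.reg 11 = j) (hj : j < K) (hmx : s.mem (n + i) = x) (hx : x < K) :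
    (eval G copyRow s).mem = s.mem ∧
    (∀ y < K, gTab K (eval G copyRow s) j y = hTab K s x y) ∧
    (∀ a, (∀ y < K, a ≠ K + j * K + y) → (eval G copyRow s).val a = s.val a) := by
  have := loop_induction (G := G) (r := 16) (l := 2) (s := s) (c := prims [.add 19 0 10,
    .load 22 19] (seq (hAddr 21 22 16) (seq (gAddr 20 11 16) (prim (.vcopy 20 21)))))
    (fun N s' => s'.mem = s.mem ∧ (∀ y < N, gTab K s' j y = hTab K s x y) ∧
      (∀ a, (∀ y < N, a ≠ K + j * K + y) → s'.val a = s.val a)) ?_ ?_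
  · rwa [hs.reg2] at this
  · exact ⟨rfl, fun y hy => absurd hy (Nat.not_lt_zero y), fun _ _ => rfl⟩
  rintro y hy s1 hf1 h16 ⟨a1, a2, a3⟩
  rw [hs.reg2] at hy
  have c1 : Consts n K s1 := hs.congr fun m hm => hf1 m (by omega) (by revert m; decide)
  have f10 : s1.reg 10 = i := by rw [hf1 10 (by decide) (by decide), h10]
  have f11 : s1.reg 11 = j := by rw [hf1 11 (by decide) (by decide), h11]
  have hg := mul_add_lt hj hy
  rw [eval_prims, eval.eq_3, eval.eq_3, eval_hAddr]
  · rw [eval_gAddr]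
    · simp only [List.foldl, eval, Instr.act, f10, f11, h16, c1.reg2, c1.reg6, c1.reg0, a1, hmx,
        ne_eq, not_false_eq_true, Function.update_of_ne, Function.update_self, Nat.reduceEqDiff,
        setReg, true_and, gTab]
      have hsrc : s1.val (K + K * K + x * K + y) = hTab K s x y :=
        a3 _ fun y' hy' => by omega
      rw [hsrc]
      refine ⟨fun y' hy' => ?_, fun a ha => ?_⟩
      · rcases Nat.lt_succ_iff_lt_or_eq.1 hy' with hy' | rfl
        · rw [Function.update_of_ne (by omega)]
          exact a2 y' hy'
        · rw [Function.update_self]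
      · rw [Function.update_of_ne (ha y (Nat.lt_succ_self y))]
        exact a3 a fun y' hy' => ha y' (hy'.trans (Nat.lt_succ_self y))
    · simp [Instr.act, f11, c1.reg2]; omega
    all_goals decide
  · simp [Instr.act, f10, c1.reg2, c1.reg0, a1, hmx]; omega
  all_goals decide

/-- The row of `j` is overwritten only after `h` is complete, so `IsMerge` speaks of the old tables.
-/
theorem eval_merge {G : OCFGame n} {K i j x : ℕ} {s : Store} (hs : Consts n K s) (hK : 3 ≤ K)
    (hnK : n < K) (hm : ∀ k, s.mem (K + K + K + k) = 0) (h10 : s.reg 10 = i) (h11 : s.reg 11 = j)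
    (hi : i < n) (hj : j ≤ n) (hmx : s.mem (n + i) = x) (hx : x < K) :
    (eval G merge s).mem = Function.update s.mem (K + K + i) 1 ∧
    (∀ a < 2, (eval G merge s).val a = s.val a) ∧
    (∀ k ≤ n, k ≠ j → ∀ y < K, gTab K (eval G merge s) k y = gTab K s k y) ∧
    ∃ h, IsMerge (gTab K s i) (gTab K s j) (fun p q => G.natOracle (pairVec i p j q)) K h ∧
      ∀ y < K, gTab K (eval G merge s) j y = h x y := by
  obtain ⟨a1, a2, a3⟩ := eval_fillTable (G := G) hs hK hm h10 h11 (by omega) (by omega)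
  have f10 : (eval G fillTable s).reg 10 = i := by rw [eval_reg _ _ _ (by decide), h10]
  have f11 : (eval G fillTable s).reg 11 = j := by rw [eval_reg _ _ _ (by decide), h11]
  have c1 : Consts n K (eval G fillTable s) := hs.eval (by decide)
  rw [merge, eval.eq_3, eval.eq_3]
  set s1 := eval G fillTable s
  clear_value s1
  obtain ⟨b1, b2, b3⟩ := eval_copyRow (G := G) c1 f10 f11 (by omega) (by rw [a1, hmx]) hx
  have f10' : (eval G copyRow s1).reg 10 = i := by rw [eval_reg _ _ _ (by decide), f10]
  have c2 : Consts n K (eval G copyRow s1) := c1.eval (by decide)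
  set s2 := eval G copyRow s1
  clear_value s2
  have hval : (eval G (prims [.add 19 7 10] (prim (.store 19 1))) s2).val = s2.val := rfl
  have hmem : (eval G (prims [.add 19 7 10] (prim (.store 19 1))) s2).mem
      = Function.update s2.mem (K + K + i) 1 := by
    simp [prims, eval, Instr.act, c2.reg7, c2.reg1, f10']
  simp only [gTab, hval, hmem]
  refine ⟨by rw [b1, a1], fun a ha => ?_, fun k hk hkj y hy => ?_, hTab K s1, a3, b2⟩
  · rw [b3 a fun y _ => by omega, a2 a (by omega) (by omega)]
  · have := mul_add_lt (hk.trans_lt hnK) hy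
    rw [b3 _ fun y' hy' he => hkj (mul_add_inj (x := k) (x' := j) hy hy' (by omega)).1,
      a2 _ (by omega) (by omega)]

/-- The invariant of the elimination: `A` is the set of the agents that are left, and `n`. -/
structure Inv (G : OCFGame n) (c : G.Coalition) (V : ℝ) (K : ℕ) (A : Finset ℕ) (s : Store) :
    Prop where
  consts : Consts n K s
  three_le : 3 ≤ K
  lt : n < K
  bound : ∀ k, G.extend c k < K
  -- The case `k = n` is cell `2 * n`, which holds `0`, the bound of the extra index.
  weights : ∀ k ≤ n, s.mem (n + k) = G.extend c k
  subset : A ⊆ Finset.range (n + 1)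
  root : n ∈ A
  -- Flag `0` means present, so the untouched memory declares every agent present.
  alive : ∀ k ≤ n, s.mem (K + K + k) < 1 ↔ k ∈ A
  scratch : ∀ k, s.mem (K + K + K + k) = 0
  threshold : s.val 0 = V
  zero : s.val 1 = 0
  opt : IsOptimum G.natOracle (G.extend c) A (gTab K s) (G.superadditiveCover c)

theorem Inv.congr {G : OCFGame n} {c : G.Coalition} {V : ℝ} {K : ℕ} {A : Finset ℕ}
    {s s' : Store} (h : Inv G c V K A s) (hr : ∀ m ≤ 8, s'.reg m = s.reg m) (hs : Same s s') :
    Inv G c V K A s' where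
  consts := h.consts.congr hr
  three_le := h.three_le
  lt := h.lt
  bound := h.bound
  weights := by rw [hs.1]; exact h.weights
  subset := h.subset
  root := h.root
  alive := by rw [hs.1]; exact h.alive
  scratch := by rw [hs.1]; exact h.scratch
  threshold := by rw [hs.2 0 (by decide), h.threshold]
  zero := by rw [hs.2 1 (by decide), h.zero]
  opt := h.opt.congr fun k _ a _ => hs.2 _ (by have := h.three_le; omega)

theorem Inv.setReg {G : OCFGame n} {c : G.Coalition} {V : ℝ} {K : ℕ} {A : Finset ℕ}
    {s : Store} (h : Inv G c V K A s) {r : ℕ} (hr : 8 < r) (k : ℕ) :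
    Inv G c V K A (setReg s r k) :=
  h.congr (fun m hm => Function.update_of_ne (by omega) _ _) ⟨rfl, fun _ _ => rfl⟩

/-- Every pair that passes the test may be merged safely; the last clause, that a passing pair does
shrink `A`, is needed only for progress. -/
theorem eval_visit {G : OCFGame n} (hG : G.IsKOCF 2) {c : G.Coalition} {V : ℝ} {K : ℕ}
    {A : Finset ℕ} {s : Store} {i j : ℕ} (h : Inv G c V K A s) (h10 : s.reg 10 = i)
    (h11 : s.reg 11 = j) (hi : i < n) (hj : j ≤ n) :
    ∃ A' ⊆ A, Inv G c V K A' (eval G visit s) ∧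
      (i ∈ A → j ∈ A → i ≠ j → G.IsIsolated K A i j → A' ≠ A) := by
  have hK := h.lt
  rw [visit, eval_prims]
  set s1 := List.foldl (fun s i => Instr.act G s i) s _ with hs1
  have e1 : Same s s1 := ⟨rfl, fun _ _ => rfl⟩
  have i1 : Inv G c V K A s1 := h.congr (by intro m hm; interval_cases m <;> rfl) e1
  have f10 : s1.reg 10 = i := h10
  have f11 : s1.reg 11 = j := h11
  have f19 : s1.reg 19 = s1.mem (K + K + i) := by simp [hs1, Instr.act, h.consts.reg7, h10]
  have f20 : s1.reg 20 = s1.mem (K + K + j) := by simp [hs1, Instr.act, h.consts.reg7, h11]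
  have f21 : s1.reg 21 = i - j + (j - i) := by simp [hs1, Instr.act, h10, h11]
  clear_value s1
  clear hs1 e1 h h10 h11
  simp only [eval.eq_4, f19, f20, f21, i1.consts.reg1, i1.consts.reg5, i1.alive i (by omega),
    i1.alive j hj]
  by_cases hiA : i ∈ A
  swap
  · rw [if_neg hiA]
    exact ⟨A, subset_rfl, i1, fun h => absurd h hiA⟩
  rw [if_pos hiA]
  by_cases hjA : j ∈ A
  swap
  · rw [if_neg hjA]
    exact ⟨A, subset_rfl, i1, fun _ h => absurd h hjA⟩
  rw [if_pos hjA]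
  by_cases hij : i = j
  · rw [if_neg (by omega)]
    exact ⟨A, subset_rfl, i1, fun _ _ h => absurd hij h⟩
  rw [if_pos (by omega), eval.eq_3, eval.eq_4]
  obtain ⟨t1, t2⟩ := eval_test (G := G) i1.consts i1.scratch i1.zero
  have i2 : Inv G c V K A (eval G test s1) :=
    i1.congr (fun m hm => eval_reg G test s1 (by revert m; decide)) t1
  have g10 : (eval G test s1).reg 10 = i := by rw [eval_reg _ _ _ (by decide), f10]
  have g11 : (eval G test s1).reg 11 = j := by rw [eval_reg _ _ _ (by decide), f11]
  have t3 : 0 < (eval G test s1).reg 17 ↔ G.IsIsolated K A i j := by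
    rw [t2, f10, f11]
    refine forall_congr' fun k => forall_congr' fun hk => ?_
    rw [i1.alive k hk.le]
  set s2 := eval G test s1
  clear_value s2
  rw [i2.consts.reg5]
  by_cases hiso : G.IsIsolated K A i j
  swap
  · rw [if_neg (mt t3.1 hiso)]
    exact ⟨A, subset_rfl, i2, fun _ _ _ h => absurd h hiso⟩
  rw [if_pos (t3.2 hiso)]
  obtain ⟨m1, m2, m3, tab, m4, m5⟩ := eval_merge (G := G) i2.consts i2.three_le hK i2.scratch
    g10 g11 hi hj (i2.weights i hi.le) (i2.bound i)
  refine ⟨A.erase i, Finset.erase_subset i A, ?_, fun h _ _ _ h' => ?_⟩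
  · have c3 : Consts n K (eval G merge s2) := i2.consts.eval (by decide)
    refine ⟨c3, i2.three_le, hK, i2.bound, ?_, ?_, ?_, ?_, ?_, ?_, ?_, ?_⟩
    · intro k hk
      rw [m1, Function.update_of_ne (by omega), i2.weights k hk]
    · exact (Finset.erase_subset i A).trans i2.subset
    · exact Finset.mem_erase.2 ⟨hi.ne', i2.root⟩
    · intro k hk
      rw [m1, Finset.mem_erase]
      by_cases hki : k = i
      · subst hki; simp
      · rw [Function.update_of_ne (by omega), i2.alive k hk]
        simp [hki]
    · intro k
      rw [m1, Function.update_of_ne (by omega), i2.scratch k]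
    · rw [m2 0 (by decide), i2.threshold]
    · rw [m2 1 (by decide), i2.zero]
    · refine OCFGame.isOptimum_merge hG i2.opt hi hiA hjA hij i2.bound hiso m4 m5 ?_
      intro k hk _ hkj y hy
      have := Finset.mem_range.1 (i2.subset hk)
      exact m3 k (by omega) hkj y hy
  · rw [← h'] at h
    exact (Finset.notMem_erase i A) h

/-- Each round removes an agent as long as one is left, so after `N` rounds `A.card + N ≤ n + 1`;
with `N = n` only the extra index survives. -/
theorem eval_eliminate {G : OCFGame n} (hG : G.IsKOCF 2) (hT : G.HasTreeInteraction)
    {c : G.Coalition} {V : ℝ} {K : ℕ} {s : Store}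
    (h : Inv G c V K (Finset.range (n + 1)) s) : Inv G c V K {n} (eval G eliminate s) := by
  have key : ∃ A, Inv G c V K A (eval G eliminate s) ∧ A.card + n ≤ n + 1 := by
    have := loop_induction (G := G) (c := loop 10 0 (loop 11 3 visit)) (r := 9) (l := 0) (s := s)
      (fun N s' => ∃ A, Inv G c V K A s' ∧ (A.card + N ≤ n + 1)) ?_ ?_
    · rwa [h.consts.reg0] at this
    · exact ⟨_, h.setReg (by decide) 0, by simp⟩
    rintro r hr s1 - - ⟨A, i1, hcard⟩
    rw [h.consts.reg0] at hr
    -- If only `n` is left, the card bound persists because the round number is below `n`.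
    by_cases hA : A = {n}
    · subst hA
      have := loop_induction (G := G) (c := loop 11 3 visit) (r := 10) (l := 0) (s := s1)
        (fun _ s' => ∃ A ⊆ {n}, Inv G c V K A s') ⟨_, subset_rfl, i1.setReg (by decide) 0⟩ ?_
      · obtain ⟨A', hA', i2⟩ := this
        refine ⟨A', i2.setReg (by decide) _, ?_⟩
        have := Finset.card_le_card hA'
        rw [Finset.card_singleton] at this
        omega
      rintro i hi s2 - h10 ⟨A', hA', i2⟩
      rw [i1.consts.reg0] at hi
      have := loop_induction (G := G) (c := visit) (r := 11) (l := 3) (s := s2)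
        (fun _ s' => ∃ A ⊆ {n}, Inv G c V K A s') ⟨_, hA', i2.setReg (by decide) 0⟩ ?_
      · obtain ⟨A'', hA'', i3⟩ := this
        exact ⟨A'', hA'', i3.setReg (by decide) _⟩
      rintro j hj s3 hf3 h11 ⟨A'', hA'', i3⟩
      rw [i2.consts.reg3] at hj
      obtain ⟨B, hB, i4, -⟩ := eval_visit hG i3
        ((hf3 10 (by decide) (by decide)).trans h10) h11 hi (by omega)
      exact ⟨B, hB.trans hA'', i4.setReg (by decide) _⟩
    · obtain ⟨i₀, hi₀, j₀, hj₀, hiA, hjA, hij, hiso⟩ :=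
        OCFGame.exists_isIsolated hT K i1.subset i1.root hA
      have := loop_induction (G := G) (c := loop 11 3 visit) (r := 10) (l := 0) (s := s1)
        (fun N s' => ∃ A' ⊆ A, Inv G c V K A' s' ∧ (i₀ < N → A' ≠ A))
        ⟨_, subset_rfl, i1.setReg (by decide) 0, fun h => absurd h (Nat.not_lt_zero _)⟩ ?_
      · obtain ⟨A', hA', i2, hne⟩ := this
        rw [i1.consts.reg0] at hne
        refine ⟨A', i2.setReg (by decide) _, ?_⟩
        have := Finset.card_lt_card (hA'.ssubset_of_ne (hne hi₀))
        omega
      rintro i hi s2 - h10 ⟨A', hA', i2, hne⟩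
      rw [i1.consts.reg0] at hi
      have := loop_induction (G := G) (c := visit) (r := 11) (l := 3) (s := s2)
        (fun N s' => ∃ A' ⊆ A, Inv G c V K A' s' ∧ (i₀ < i ∨ i₀ = i ∧ j₀ < N → A' ≠ A))
        ⟨_, hA', i2.setReg (by decide) 0, fun h => hne (by omega)⟩ ?_
      · obtain ⟨A'', hA'', i3, hne'⟩ := this
        rw [i2.consts.reg3] at hne'
        exact ⟨A'', hA'', i3.setReg (by decide) _, fun h => hne' (by omega)⟩
      rintro j hj s3 hf3 h11 ⟨A'', hA'', i3, hne'⟩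
      rw [i2.consts.reg3] at hj
      obtain ⟨B, hB, i4, hB'⟩ := eval_visit hG i3
        ((hf3 10 (by decide) (by decide)).trans h10) h11 hi (by omega)
      refine ⟨B, hB.trans hA'', i4.setReg (by decide) _, fun hlt hBA => ?_⟩
      -- If the set is still `A` after this visit, nothing was removed earlier in the round. Then
      -- the pair `(i₀, j₀)`, chosen for `A`, still passes when it is visited, a contradiction.
      have hAA : A'' = A := hA''.antisymm (hBA ▸ hB)
      by_cases hcase : i₀ < i ∨ i₀ = i ∧ j₀ < j
      · exact hne' hcase hAA
      · obtain ⟨rfl, rfl⟩ : i₀ = i ∧ j₀ = j := by omega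
        subst hAA
        exact hB' hiA hjA hij hiso hBA
  obtain ⟨A, i1, hcard⟩ := key
  have : A = {n} :=
    (Finset.eq_of_subset_of_card_le (Finset.singleton_subset_iff.2 i1.root)
      (by rw [Finset.card_singleton]; omega)).symm
  exact this ▸ i1

end Cmd

/-! ### Input, output and the polynomial bound -/

namespace Cmd

variable {n : ℕ}

open MergeDP

/-- The data of the initial configuration. -/
noncomputable def input (G : OCFGame n) (c : G.Coalition) (V : ℚ) : Store :=
  ⟨(initialConfig G c V).reg, (initialConfig G c V).mem, (initialConfig G c V).val⟩

/-- The bound `K` computed by the program. -/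
def boundOf (G : OCFGame n) : ℕ := n + 3 + ∑ i, G.W i

/-- The sum of the weights replaces their maximum because it needs only additions. The summand `n +
3` makes room for `n + 1` table rows and the value cells `0`, `1`, `2`. -/
theorem boundOf_le (G : OCFGame n) : boundOf G ≤ n + n * G.maxWeight + 3 := by
  have : ∑ i, G.W i ≤ n * G.maxWeight := by
    have := Finset.sum_le_card_nsmul Finset.univ G.W G.maxWeight
      fun i hi => Finset.le_sup (f := G.W) hi
    simpa using this
  unfold boundOf
  omega

theorem extend_lt_boundOf (G : OCFGame n) (c : G.Coalition) (k : ℕ) :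
    G.extend c k < boundOf G := by
  unfold boundOf OCFGame.extend
  split_ifs with h
  · have h1 : c.1 ⟨k, h⟩ ≤ G.W ⟨k, h⟩ := c.2 _
    have h2 := Finset.single_le_sum (f := G.W) (fun _ _ => Nat.zero_le _)
      (Finset.mem_univ ⟨k, h⟩)
    omega
  · omega

theorem input_weight (G : OCFGame n) (c : G.Coalition) (V : ℚ) {k : ℕ} (hk : k < n) :
    (input G c V).mem k = G.W ⟨k, hk⟩ := by
  simp [input, initialConfig, hk]

theorem input_coalition (G : OCFGame n) (c : G.Coalition) (V : ℚ) (k : ℕ) :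
    (input G c V).mem (n + k) = G.extend c k := by
  simp [input, initialConfig, OCFGame.extend]

theorem eval_computeBound (G : OCFGame n) (c : G.Coalition) (V : ℚ) :
    let s' := eval G computeBound (eval G (prim (.const 1 1)) (input G c V))
    s'.mem = (input G c V).mem ∧ s'.val = (input G c V).val ∧ s'.reg 0 = n ∧ s'.reg 1 = 1 ∧
      s'.reg 2 = boundOf G ∧ s'.reg 3 = n + 1 ∧ s'.reg 4 = 2 ∧ s'.reg 5 = 0 := by
  intro s'
  have key : s'.mem = (input G c V).mem ∧ s'.val = (input G c V).val ∧
      s'.reg 2 = n + 3 + ∑ k ∈ Finset.range n, (input G c V).mem k := by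
    simp only [s', computeBound, eval_prims, List.foldl]
    refine loop_induction (G := G) (r := 12) (l := 0) (c := prims [.load 19 12] (prim (.add 2 2 19)))
      (fun N s' => s'.mem = (input G c V).mem ∧ s'.val = (input G c V).val ∧
        s'.reg 2 = n + 3 + ∑ k ∈ Finset.range N, (input G c V).mem k) ?_ ?_
    · refine ⟨rfl, rfl, ?_⟩
      simp [setReg, Instr.act, eval, input, initialConfig]
    · rintro k - s1 - h12 ⟨a1, a2, a3⟩
      refine ⟨a1, a2, ?_⟩
      simp only [setReg, prims, List.foldr, eval, Instr.act, h12, a1, a3, ne_eq,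
        not_false_eq_true, Function.update_of_ne, Function.update_self, Nat.reduceEqDiff,
        Finset.sum_range_succ]
      omega
  obtain ⟨h1, h2, h3⟩ := key
  have hsum : ∑ k ∈ Finset.range n, (input G c V).mem k = ∑ i, G.W i := by
    rw [← Fin.sum_univ_eq_sum_range]
    exact Finset.sum_congr rfl fun i _ => input_weight G c V i.2
  rw [hsum] at h3
  refine ⟨h1, h2, ?_, ?_, h3, ?_, ?_, ?_⟩
  · simp only [s']
    rw [eval_reg _ _ _ (by decide)]
    rfl
  · simp only [s']
    rw [eval_reg _ _ _ (by decide)]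
    rfl
  · simp only [s', computeBound, eval_prims, List.foldl]
    rw [eval_reg _ _ _ (by decide)]
    rfl
  · simp only [s', computeBound, eval_prims, List.foldl]
    rw [eval_reg _ _ _ (by decide)]
    rfl
  · simp only [s']
    rw [eval_reg _ _ _ (by decide)]
    rfl

/-- Input memory vanishes from cell `2 * n` on and value memory from cell `1` on; hence flags, query
vector and tables start at zero without initialisation. -/
theorem inv_computeBases (G : OCFGame n) (c : G.Coalition) (V : ℚ) :
    Inv G c V (boundOf G) (Finset.range (n + 1))
      (eval G computeBases (eval G computeBound (eval G (prim (.const 1 1)) (input G c V)))) := by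
  obtain ⟨h1, h2, r0, r1, r2, r3, r4, r5⟩ := eval_computeBound G c V
  set s := eval G computeBound (eval G (prim (.const 1 1)) (input G c V))
  clear_value s
  have hK : n + 3 ≤ boundOf G := Nat.le_add_right _ _
  rw [computeBases, eval.eq_3, eval_mul G s (by rw [r2]) (by decide) (by decide) (by decide)
    (by decide), eval_prims]
  have hmem : ∀ a, 2 * n ≤ a → s.mem a = 0 := by
    intro a ha
    rw [h1]
    obtain ⟨k, rfl⟩ := Nat.exists_eq_add_of_le (show n ≤ a by omega)
    rw [input_coalition]
    exact G.extend_of_le c (by omega)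
  have hval : ∀ a, s.val a = if a = 0 then (V : ℝ) else 0 := fun a => by
    rw [h2]; rfl
  constructor
  · constructor <;> simp [eval, Instr.act, r0, r1, r2, r3, r4, r5, Nat.add_comm]
  · omega
  · omega
  · exact extend_lt_boundOf G c
  · intro k _
    change s.mem (n + k) = _
    rw [h1, input_coalition]
  · exact subset_rfl
  · simp
  · intro k hk
    change s.mem _ < 1 ↔ _
    rw [hmem _ (by omega)]
    simp
    omega
  · intro k
    exact hmem _ (by omega)
  · exact (hval 0).trans (if_pos rfl)
  · exact (hval 1).trans (if_neg one_ne_zero)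
  · exact G.isOptimum_superadditiveCover c fun k _ a _ => (hval _).trans (if_neg (by omega))

/-- The extra index has bound `0`, so its entry at `0` is the optimum. The threshold is compared
before cell `0` is overwritten by the result. -/
theorem eval_answer {G : OCFGame n} {c : G.Coalition} {V : ℝ} {K : ℕ} {s : Store}
    (h : Inv G c V K {n} s) :
    (eval G answer s).val 0 = G.superadditiveCover c ∧
    (V ≤ G.superadditiveCover c → (eval G answer s).reg 17 = 1) ∧
    (¬ V ≤ G.superadditiveCover c → (eval G answer s).reg 17 = 0) := by
  have hopt : s.val (K + n * K) = G.superadditiveCover c :=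
    h.opt.eq_of_singleton (G.extend_of_le c le_rfl) G.natOracle_zero
  have hc := h.consts
  have hlt := h.lt
  rw [answer, eval.eq_3, eval.eq_3, eval_gAddr G s (by rw [hc.reg0, hc.reg2]; omega)]
  · simp only [eval, hc.reg0, hc.reg2, hc.reg5, ne_eq, not_false_eq_true, Function.update_of_ne,
      Function.update_self, Nat.reduceEqDiff, Nat.add_zero, hopt, h.threshold]
    split_ifs with hle <;> simp [Instr.act, hle, hc.reg5, hopt]
  all_goals decide

theorem code_seq (c d : Cmd) (o : ℕ) : (seq c d).code o = c.code o ++ d.code (o + c.size) := rfl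

/-- The compiled program computes the optimal value and compares it with the threshold, within
polynomial time. -/
theorem run_optVal {G : OCFGame n} (hG : G.IsKOCF 2) (hT : G.HasTreeInteraction)
    (c : G.Coalition) (V : ℚ) :
    ∃ (t : ℕ) (s : Config), Run (optVal.code 0) G (initialConfig G c V) t s ∧
      t ≤ MvPolynomial.eval ![n, G.maxWeight]
        (optVal.time (MvPolynomial.X 0 + MvPolynomial.X 0 * MvPolynomial.X 1 + 3)) ∧
      s.val 0 = G.superadditiveCover c ∧
      ((V : ℝ) ≤ G.superadditiveCover c → s.reg 0 = 1) ∧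
      (¬ (V : ℝ) ≤ G.superadditiveCover c → s.reg 0 = 0) := by
  have hB : n + 1 ≤ boundOf G := by unfold boundOf; omega
  obtain ⟨-, -, r0, r1, r2, r3, -, -⟩ := eval_computeBound G c V
  have hinv := inv_computeBases G c V
  obtain ⟨P, hP⟩ : ∃ P, P = optVal.code 0 := ⟨_, rfl⟩
  have hocc : OccursAt P 0 (optVal.code 0) := fun k _ => by rw [hP, Nat.zero_add]
  have hlen : P.length = optVal.size := by rw [hP, length_code]
  rw [← hP]
  have htime : optVal.time (boundOf G) ≤ MvPolynomial.eval ![n, G.maxWeight]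
      (optVal.time (MvPolynomial.X 0 + MvPolynomial.X 0 * MvPolynomial.X 1 + 3)) := by
    rw [map_time]
    refine time_mono ((boundOf_le G).trans (le_of_eq ?_)) _
    simp
  rw [optVal, code_seq, code_seq, code_seq, code_seq] at hocc
  have o1 := hocc.left
  have o2 := (hocc.right (by rw [length_code])).left
  have o3 := ((hocc.right (by rw [length_code])).right (by rw [length_code])).left
  have o4 := (((hocc.right (by rw [length_code])).right (by rw [length_code])).right
    (by rw [length_code])).left
  have o5 := (((hocc.right (by rw [length_code])).right (by rw [length_code])).right
    (by rw [length_code])).right (by rw [length_code])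
  -- Register `1` is not yet set, so nothing is protected; the empty list only admits programs
  -- without loops.
  obtain ⟨t1, l1, run1⟩ := run_code (G := G) (L := []) hB _ _ (input G c V) (by decide) (by simp)
    (by simp) o1
  obtain ⟨t2, l2, run2⟩ := run_code (G := G) hB _ _ (eval G (prim (.const 1 1)) (input G c V))
    wf_computeBound (by
      intro r hr
      simp only [List.mem_cons, List.not_mem_nil, or_false] at hr
      rcases hr with rfl | rfl
      · exact (show (n : ℕ) ≤ _ by omega)
      · exact (show 1 ≤ _ by omega)) (Or.inl rfl) o2
  generalize hs2 : eval G computeBound (eval G (prim (.const 1 1)) (input G c V)) = s2 at *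
  obtain ⟨t3, l3, run3⟩ := run_code (G := G) hB _ _ s2 wf_computeBases (by
      intro r hr
      simp only [List.mem_cons, List.not_mem_nil, or_false] at hr
      rcases hr with rfl | rfl | rfl | rfl <;> omega) (Or.inl r1) o3
  generalize hs3 : eval G computeBases s2 = s3 at *
  have hc := hinv.consts
  obtain ⟨t4, l4, run4⟩ := run_code (G := G) hB _ _ s3 wf_eliminate (by
      intro r hr
      simp only [List.mem_cons, List.not_mem_nil, or_false] at hr
      rcases hr with rfl | rfl | rfl | rfl
      · rw [hc.reg0]; omega
      · rw [hc.reg1]; omega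
      · rw [hc.reg2]
      · rw [hc.reg3]; omega) (Or.inl hc.reg1) o4
  obtain ⟨a1, a2, a3⟩ := eval_answer (eval_eliminate hG hT hinv)
  have hc4 : Consts n (boundOf G) (eval G answer (eval G eliminate s3)) :=
    (hc.eval (by decide)).eval (by decide)
  change ∀ t' s', Run P G ((eval G answer (eval G eliminate s3)).at _) t' s' → _ at run4
  generalize hs4 : eval G answer (eval G eliminate s3) = s4 at *
  -- The answer goes into register `0`, so the protection of that register ends here.
  obtain ⟨t5, l5, run5⟩ := run_code (G := G) (L := []) hB _ _ s4 (by decide) (by simp)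
    (by simp) o5
  refine ⟨t1 + (t2 + (t3 + (t4 + (t5 + 0)))), _, run1 _ _ (run2 _ _ (run3 _ _ (run4 _ _
    (run5 _ _ (Run.halt _ ?_))))), ?_, a1, fun hV => ?_, fun hV => ?_⟩
  · refine List.getElem?_eq_none ?_
    rw [hlen]
    simp only [optVal, size, Store.at]
    omega
  · refine le_trans ?_ htime
    simp only [optVal, time] at l1 l2 l3 l4 l5 ⊢
    omega
  · simp [eval, Instr.act, Store.at, a2 hV, hc4.reg5]
  · simp [eval, Instr.act, Store.at, a3 hV, hc4.reg5]

end Cmd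

theorem mainTheorem2 :
    ∃ (P : Program) (p : MvPolynomial (Fin 2) ℕ),
      ∀ (n : ℕ) (G : OCFGame n), G.IsKOCF 2 → G.HasTreeInteraction →
        ∀ (c : G.Coalition) (V : ℚ),
          ∃ (t : ℕ) (s : Config), Run P G (initialConfig G c V) t s ∧
            t ≤ MvPolynomial.eval ![n, G.maxWeight] p ∧
            s.val 0 = G.superadditiveCover c ∧
            ((V : ℝ) ≤ G.superadditiveCover c → s.reg 0 = 1) ∧
            (¬ (V : ℝ) ≤ G.superadditiveCover c → s.reg 0 = 0) := by
  exact ⟨Cmd.optVal.code 0, Cmd.optVal.time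
    (MvPolynomial.X 0 + MvPolynomial.X 0 * MvPolynomial.X 1 + 3),
    fun _ _ hG hT c V => Cmd.run_optVal hG hT c V⟩
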